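/- Let $(M^n,g)$ be a connected Riemannian spin manifold without boundary (with $g$ at least $C^1$), with a fixed spin structure, let $k$ be a symmetric $2$-tensor on $M$, and let $\nabla$ be the Levi-Civita connection. Let $\mathcal S$ be the complex spinor bundle (the bundle associated with an irreducible complex module of the Clifford algebra with $e_ie_j+e_je_i=-2\delta_{ij}$, with a Hermitian product $\langle\cdot,\cdot\rangle$, linear in the first slot, for which vectors act skew-adjointly), with the induced connection, and let $\overline{\mathcal S}=\mathcal S\oplus\mathcal S$ be the spacetime spinor bundle with the direct sum product and connection and the Clifford multiplication $$e_i(\psi_1,\psi_2)=(e_i\psi_1,-e_i\psi_2)\quad(1\le i\le n),\qquad e_0(\psi_1,\psi_2)=(\psi_2,\psi_1).$$ For a section $\psi$ of $\overline{\mathcal S}$ and a local orthonormal frame $e_1,\dots,e_n$ put $$N=|\psi|^2,\quad X=\sum_i\langle e_ie_0\psi,\psi\rangle e_i,\quad Y=\sum_i\langle \mathbf i e_i\psi,\psi\rangle e_i,\quad \omega_{ij}=\operatorname{Im}\langle e_ie_je_0\psi,\psi\rangle .$$ These define a real function, two real vector fields and a two-form on $M$, independently of the frame. **Theorem.** Let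 $\psi$ be a $C^1$ section of $\overline{\mathcal S}$ such that (with summation over repeated indices) $$\nabla_i\psi=-\tfrac12k_{ij}e_je_0\psi-\tfrac12\mathbf i e_i\psi .$$ Then $N,X,Y,\omega$ are differentiable and $$\begin{aligned} \nabla_iN&=-k_{ij}X_j-Y_i,\\ \nabla_iX_j&=-k_{ij}N+\omega_{ij},\\ \nabla_iY_j&=-g_{ij}N+k_{il}\omega_{jl},\\ \nabla_i\omega_{jk}&=g_{ij}X_k-g_{ik}X_j-k_{ij}Y_k+k_{ik}Y_j . \end{aligned}$$ Moreover the function $$N^2-|X|^2-|Y|^2+\tfrac12|\omega|^2,\qquad |\omega|^2=\sum_{i,j}\omega_{ij}^2,$$ is constant on $M$. -/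

import Mathlib

open Bundle Manifold
open scoped ContDiff

noncomputable section

namespace KillingBilinears

/-! ### Clifford algebra and spinor modules -/

/-- The quadratic form `v ↦ -|v|²` on `ℝⁿ`; its Clifford algebra has `v · v = -|v|²`. -/
def negForm (n : ℕ) : QuadraticForm ℝ (EuclideanSpace ℝ (Fin n)) :=
  LinearMap.BilinMap.toQuadraticMap (-innerₗ (EuclideanSpace ℝ (Fin n)))

/-- The real Clifford algebra of `ℝⁿ` with relations `e_i e_j + e_j e_i = -2 δ_ij`. -/
abbrev Cl (n : ℕ) : Type := CliffordAlgebra (negForm n)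

/-- The standard basis vector `e_i` of `ℝⁿ`, as an element of the Clifford algebra. -/
def gen {n : ℕ} (i : Fin n) : Cl n :=
  CliffordAlgebra.ι (negForm n) (EuclideanSpace.single i 1)

variable {n : ℕ} {Δ : Type*} [NormedAddCommGroup Δ] [InnerProductSpace ℂ Δ]

/-- A complex spinor module for `ℝⁿ`: an irreducible complex representation of the Clifford
algebra, with a Hermitian inner product for which Clifford multiplication by vectors is
skew-adjoint. -/
structure SpinorModule (n : ℕ) (Δ : Type*) [NormedAddCommGroup Δ] [InnerProductSpace ℂ Δ] where
  /-- Clifford multiplication -/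
  act : Cl n →ₐ[ℝ] Module.End ℂ Δ
  skew : ∀ (v : EuclideanSpace ℝ (Fin n)) (φ χ : Δ),
    inner ℂ (act (CliffordAlgebra.ι (negForm n) v) φ) χ =
      -inner ℂ φ (act (CliffordAlgebra.ι (negForm n) v) χ)
  nontrivial : Nontrivial Δ
  irreducible : ∀ p : Submodule ℂ Δ, (∀ a : Cl n, ∀ φ ∈ p, act a φ ∈ p) → p = ⊥ ∨ p = ⊤

/-- The fibre `Δ ⊕ Δ` of the spacetime spinor bundle, with the direct sum Hermitian product. -/
abbrev Spacetime (Δ : Type*) : Type _ := WithLp 2 (Δ × Δ)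

/-- Clifford multiplication by `e_0`: `e_0 (ψ₁, ψ₂) = (ψ₂, ψ₁)`. -/
def cl0 (φ : Spacetime Δ) : Spacetime Δ := WithLp.toLp 2 (φ.snd, φ.fst)

/-- Clifford multiplication by `e_i`, `1 ≤ i ≤ n`: `e_i (ψ₁, ψ₂) = (e_i ψ₁, -e_i ψ₂)`. -/
def cl (ρ : SpinorModule n Δ) (i : Fin n) (φ : Spacetime Δ) : Spacetime Δ :=
  WithLp.toLp 2 (ρ.act (gen i) φ.fst, -ρ.act (gen i) φ.snd)

/-- The diagonal action of the Clifford algebra (in particular of the spin group) on `Δ ⊕ Δ`,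
by which the spacetime spinor bundle is associated with the spin structure. -/
def diagAct (ρ : SpinorModule n Δ) (a : Cl n) (φ : Spacetime Δ) : Spacetime Δ :=
  WithLp.toLp 2 (ρ.act a φ.fst, ρ.act a φ.snd)

/-! The bilinears at a point, in an orthonormal frame. The pairing `⟨φ, χ⟩`, linear in `φ`,
is `inner ℂ χ φ` in Mathlib's convention. -/

/-- `X_i = ⟨e_i e_0 φ, φ⟩`; this number is real. -/
def Xcomp (ρ : SpinorModule n Δ) (φ : Spacetime Δ) (i : Fin n) : ℝ :=
  (inner ℂ φ (cl ρ i (cl0 φ))).re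

/-- `Y_i = ⟨𝐢 e_i φ, φ⟩`; this number is real. -/
def Ycomp (ρ : SpinorModule n Δ) (φ : Spacetime Δ) (i : Fin n) : ℝ :=
  (inner ℂ φ (Complex.I • cl ρ i φ)).re

/-- `ω_ij = Im ⟨e_i e_j e_0 φ, φ⟩`. -/
def omegaComp (ρ : SpinorModule n Δ) (φ : Spacetime Δ) (i j : Fin n) : ℝ :=
  (inner ℂ φ (cl ρ i (cl ρ j (cl0 φ)))).im

/-! ### Spin structures, spinor fields and the spinor connection -/

/-- The standard model with corners of `ℝⁿ` (manifolds without boundary). -/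
abbrev model (n : ℕ) := 𝓘(ℝ, EuclideanSpace ℝ (Fin n))

variable {M : Type*} [TopologicalSpace M] [ChartedSpace (EuclideanSpace ℝ (Fin n)) M]
  [IsManifold (model n) ∞ M]
  [RiemannianBundle (fun x : M => TangentSpace (model n) x)]

/-- A spin structure on a Riemannian manifold, given by local orthonormal frames on an open cover
and a cocycle of transition functions with values in `Spin(n)` that lifts the transition matrices
`⟨e^a_i, e^b_j⟩` of the frames along the double cover `Spin(n) → SO(n)`, `g ↦ (v ↦ g v g⁻¹)`. -/
structure SpinStructure (n : ℕ) (M : Type*) [TopologicalSpace M]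
    [ChartedSpace (EuclideanSpace ℝ (Fin n)) M] [IsManifold (model n) ∞ M]
    [RiemannianBundle (fun x : M => TangentSpace (model n) x)] (κ : Type*) where
  /-- the open cover -/
  U : κ → Set M
  isOpen : ∀ a, IsOpen (U a)
  cover : ∀ x, ∃ a, x ∈ U a
  /-- the local orthonormal frames -/
  frame : κ → Fin n → (x : M) → TangentSpace (model n) x
  frame_contMDiffOn : ∀ a i, ContMDiffOn (model n)
    ((model n).prod 𝓘(ℝ, EuclideanSpace ℝ (Fin n))) 1 (T% (frame a i)) (U a)
  frame_orthonormal : ∀ a, ∀ x ∈ U a, Orthonormal ℝ (fun i => frame a i x)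
  /-- the `Spin(n)`-valued transition functions -/
  trans : κ → κ → M → Cl n
  trans_mem : ∀ a b, ∀ x ∈ U a ∩ U b, trans a b x ∈ spinGroup (negForm n)
  trans_contMDiffOn : ∀ a b (l : Cl n →ₗ[ℝ] ℝ),
    ContMDiffOn (model n) 𝓘(ℝ, ℝ) 1 (fun x => l (trans a b x)) (U a ∩ U b)
  trans_cocycle : ∀ a b c, ∀ x ∈ U a ∩ U b ∩ U c,
    trans a b x * trans b c x = trans a c x
  trans_lifts : ∀ a b, ∀ x ∈ U a ∩ U b, ∀ j,
    trans a b x * gen j =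
      (∑ i, (inner ℝ (frame a i x) (frame b j x) : ℝ) • gen i) * trans a b x

variable {κ : Type*}

/-- An index of the cover whose open set contains the given point. -/
def SpinStructure.indexAt (S : SpinStructure n M κ) (x : M) : κ := (S.cover x).choose

/-- A `C¹` section of the spacetime spinor bundle `𝒮 ⊕ 𝒮`, given by its local representatives. -/
structure SpinorField (S : SpinStructure n M κ) (ρ : SpinorModule n Δ) where
  /-- the representative of the section in the frame with the given index -/
  rep : κ → M → Spacetime Δ
  contMDiffOn : ∀ a, ContMDiffOn (model n) 𝓘(ℝ, Spacetime Δ) 1 (rep a) (S.U a)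
  compat : ∀ a b, ∀ x ∈ S.U a ∩ S.U b, rep a x = diagAct ρ (S.trans a b x) (rep b x)

/-- A covariant derivative on the tangent bundle is the Levi-Civita connection if it is metric
and torsion-free. -/
structure IsLeviCivita [IsContMDiffRiemannianBundle (model n) 1 (EuclideanSpace ℝ (Fin n))
      (fun x : M => TangentSpace (model n) x)]
    (D : CovariantDerivative (model n) (EuclideanSpace ℝ (Fin n))
      (fun x : M => TangentSpace (model n) x)) : Prop where
  metric : D.IsMetricCompatible
  torsion : D.torsion = 0

/-- The connection induced by `D` on the spacetime spinor bundle, in the frame with index `a`: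
`∇_u ψ = ∂_u ψ + ¼ ∑_{j,k} g(D_u e_j, e_k) e_j e_k ψ`. -/
def spinConn {S : SpinStructure n M κ} {ρ : SpinorModule n Δ}
    (D : CovariantDerivative (model n) (EuclideanSpace ℝ (Fin n))
      (fun x : M => TangentSpace (model n) x))
    (ψ : SpinorField S ρ) (a : κ) (x : M) (u : TangentSpace (model n) x) : Spacetime Δ :=
  mvfderiv (model n) (ψ.rep a) x u +
    (1 / 4 : ℝ) • ∑ j, ∑ k,
      (inner ℝ (D (S.frame a j) x u) (S.frame a k x) : ℝ) • cl ρ j (cl ρ k (ψ.rep a x))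

/-- The equation `∇_i ψ = -½ k_ij e_j e_0 ψ - ½ 𝐢 e_i ψ`. -/
def IsKilling {S : SpinStructure n M κ} {ρ : SpinorModule n Δ}
    (D : CovariantDerivative (model n) (EuclideanSpace ℝ (Fin n))
      (fun x : M => TangentSpace (model n) x))
    (k : (x : M) → TangentSpace (model n) x →L[ℝ] TangentSpace (model n) x →L[ℝ] ℝ)
    (ψ : SpinorField S ρ) : Prop :=
  ∀ a, ∀ x ∈ S.U a, ∀ i,
    spinConn D ψ a x (S.frame a i x) =
      -((1 / 2 : ℝ) • ∑ j, k x (S.frame a i x) (S.frame a j x) • cl ρ j (cl0 (ψ.rep a x)))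
        - (1 / 2 : ℝ) • Complex.I • cl ρ i (ψ.rep a x)

/-! ### The bilinears as tensor fields on `M` -/

namespace SpinorField

variable {S : SpinStructure n M κ} {ρ : SpinorModule n Δ}

/-- The function `N = |ψ|²`. -/
def N (ψ : SpinorField S ρ) (x : M) : ℝ := ‖ψ.rep (S.indexAt x) x‖ ^ 2

/-- The vector field `X = ⟨e_i e_0 ψ, ψ⟩ e_i`. -/
def X (ψ : SpinorField S ρ) (x : M) : TangentSpace (model n) x :=
  ∑ i, Xcomp ρ (ψ.rep (S.indexAt x) x) i • S.frame (S.indexAt x) i x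

/-- The vector field `Y = ⟨𝐢 e_i ψ, ψ⟩ e_i`. -/
def Y (ψ : SpinorField S ρ) (x : M) : TangentSpace (model n) x :=
  ∑ i, Ycomp ρ (ψ.rep (S.indexAt x) x) i • S.frame (S.indexAt x) i x

/-- The two-form `ω` with components `ω_ij = Im ⟨e_i e_j e_0 ψ, ψ⟩`. -/
def omega (ψ : SpinorField S ρ) (x : M) (v w : TangentSpace (model n) x) : ℝ :=
  ∑ i, ∑ j, omegaComp ρ (ψ.rep (S.indexAt x) x) i j *
    inner ℝ (S.frame (S.indexAt x) i x) v * inner ℝ (S.frame (S.indexAt x) j x) w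

end SpinorField

/-! ### Independence of the frame -/

section Independence

lemma SpinorModule.inner_act (ρ : SpinorModule n Δ) (a : Cl n) (φ χ : Δ) :
    inner ℂ (ρ.act a φ) χ = inner ℂ φ (ρ.act (star a) χ) := by
  induction a using CliffordAlgebra.induction generalizing φ χ with
  | algebraMap r => simp [Algebra.algebraMap_eq_smul_one, CliffordAlgebra.star_def]
  | ι v => simp [ρ.skew]
  | mul a b ha hb => simp [ha, hb]
  | add a b ha hb => rw [map_add, star_add, map_add, LinearMap.add_apply, LinearMap.add_apply,
      inner_add_left, inner_add_right, ha, hb]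

lemma inner_diagAct (ρ : SpinorModule n Δ) {a : Cl n} (ha : a ∈ spinGroup (negForm n))
    (φ χ : Spacetime Δ) : inner ℂ (diagAct ρ a φ) (diagAct ρ a χ) = inner ℂ φ χ := by
  have h : ∀ y : Δ, ρ.act (star a) (ρ.act a y) = y := fun y => by
    rw [← Module.End.mul_apply, ← map_mul, spinGroup.star_mul_self_of_mem ha]; simp
  simp [diagAct, ρ.inner_act, h]

lemma diagAct_cl0 (ρ : SpinorModule n Δ) (a : Cl n) (φ : Spacetime Δ) :
    diagAct ρ a (cl0 φ) = cl0 (diagAct ρ a φ) := rfl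

lemma diagAct_cl (ρ : SpinorModule n Δ) {a : Cl n} {A : Fin n → ℝ} {j : Fin n}
    (h : a * gen j = (∑ i, A i • gen i) * a) (φ : Spacetime Δ) :
    diagAct ρ a (cl ρ j φ) = ∑ i, A i • cl ρ i (diagAct ρ a φ) := by
  have h' : ∀ y : Δ, ρ.act a (ρ.act (gen j) y) = ∑ i, A i • ρ.act (gen i) (ρ.act a y) := by
    intro y
    have := congrArg (fun b => ρ.act b y) h
    simpa [Finset.sum_mul] using this
  apply WithLp.ofLp_injective
  rw [WithLp.ofLp_sum]
  ext
  · simp [diagAct, cl, h', Prod.fst_sum]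
  · simp [diagAct, cl, h', Prod.snd_sum]

variable {S : SpinStructure n M κ} {ρ : SpinorModule n Δ}

lemma SpinorField.inner_rep (ψ : SpinorField S ρ) {a b : κ} {x : M} (hx : x ∈ S.U a ∩ S.U b)
    (φ : Spacetime Δ) :
    inner ℂ (ψ.rep b x) φ = inner ℂ (ψ.rep a x) (diagAct ρ (S.trans a b x) φ) := by
  rw [ψ.compat a b x hx, inner_diagAct ρ (S.trans_mem a b x hx)]

lemma SpinorField.Xcomp_rep (ψ : SpinorField S ρ) {a b : κ} {x : M} (hx : x ∈ S.U a ∩ S.U b)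
    (j : Fin n) : Xcomp ρ (ψ.rep b x) j =
      ∑ i, inner ℝ (S.frame a i x) (S.frame b j x) * Xcomp ρ (ψ.rep a x) i := by
  rw [Xcomp, ψ.inner_rep hx, diagAct_cl ρ (S.trans_lifts a b x hx j), diagAct_cl0,
    ← ψ.compat a b x hx]
  simp [Xcomp, ← Complex.coe_smul]

lemma SpinorField.Ycomp_rep (ψ : SpinorField S ρ) {a b : κ} {x : M} (hx : x ∈ S.U a ∩ S.U b)
    (j : Fin n) : Ycomp ρ (ψ.rep b x) j =
      ∑ i, inner ℝ (S.frame a i x) (S.frame b j x) * Ycomp ρ (ψ.rep a x) i := by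
  have hI : ∀ (χ : Spacetime Δ) (r : ℝ),
      (inner ℂ (ψ.rep a x) (Complex.I • r • χ)).re =
        r * (inner ℂ (ψ.rep a x) (Complex.I • χ)).re := by
    intro χ r
    rw [smul_comm, ← Complex.coe_smul, inner_smul_right, Complex.re_ofReal_mul]
  rw [Ycomp, inner_smul_right, ψ.inner_rep hx, diagAct_cl ρ (S.trans_lifts a b x hx j),
    ← ψ.compat a b x hx, ← inner_smul_right, Finset.smul_sum, inner_sum, Complex.re_sum]
  simp only [hI, Ycomp]

lemma SpinorField.omegaComp_rep (ψ : SpinorField S ρ) {a b : κ} {x : M}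
    (hx : x ∈ S.U a ∩ S.U b) (i j : Fin n) : omegaComp ρ (ψ.rep b x) i j =
      ∑ p, ∑ q, inner ℝ (S.frame a p x) (S.frame b i x) *
        (inner ℝ (S.frame a q x) (S.frame b j x) * omegaComp ρ (ψ.rep a x) p q) := by
  have hcl : ∀ (p : Fin n) (c : Fin n → ℝ) (f : Fin n → Spacetime Δ),
      cl ρ p (∑ q, c q • f q) = ∑ q, c q • cl ρ p (f q) := by
    intro p c f
    have hact : ∀ g : Fin n → Δ,
        ρ.act (gen p) (∑ q, c q • g q) = ∑ q, c q • ρ.act (gen p) (g q) := by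
      intro g
      simp only [map_sum, ← Complex.coe_smul, map_smul]
    apply WithLp.ofLp_injective
    rw [WithLp.ofLp_sum]
    ext
    · have h1 : (∑ q, c q • f q).fst = ∑ q, c q • (f q).fst := by
        rw [WithLp.fst, WithLp.ofLp_sum, Prod.fst_sum]; rfl
      simp only [cl, h1, hact, Prod.fst_sum]; rfl
    · have h2 : (∑ q, c q • f q).snd = ∑ q, c q • (f q).snd := by
        rw [WithLp.snd, WithLp.ofLp_sum, Prod.snd_sum]; rfl
      simp only [cl, h2, hact, Prod.snd_sum, WithLp.ofLp_smul, Prod.smul_snd, smul_neg,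
        Finset.sum_neg_distrib]
  have him : ∀ (χ : Spacetime Δ) (r : ℝ),
      (inner ℂ (ψ.rep a x) (r • χ)).im = r * (inner ℂ (ψ.rep a x) χ).im := by
    intro χ r
    rw [← Complex.coe_smul, inner_smul_right, Complex.im_ofReal_mul]
  rw [omegaComp, ψ.inner_rep hx, diagAct_cl ρ (S.trans_lifts a b x hx i),
    diagAct_cl ρ (S.trans_lifts a b x hx j), diagAct_cl0, ← ψ.compat a b x hx,
    inner_sum, Complex.im_sum]
  simp only [hcl, him, inner_sum, Complex.im_sum, omegaComp, Finset.mul_sum]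

lemma SpinStructure.sum_frame (S : SpinStructure n M κ) {b : κ} {x : M} (hx : x ∈ S.U b)
    (v : TangentSpace (model n) x) :
    ∑ j, inner ℝ v (S.frame b j x) • S.frame b j x = v := by
  have hcard : Fintype.card (Fin n) = Module.finrank ℝ (TangentSpace (model n) x) := by
    have : Module.finrank ℝ (TangentSpace (model n) x) =
      Module.finrank ℝ (EuclideanSpace ℝ (Fin n)) := rfl
    rw [this]; simp
  have : FiniteDimensional ℝ (TangentSpace (model n) x) :=
    inferInstanceAs (FiniteDimensional ℝ (EuclideanSpace ℝ (Fin n)))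
  have ho := S.frame_orthonormal b x hx
  let e := OrthonormalBasis.mk ho
    (ho.linearIndependent.span_eq_top_of_card_eq_finrank' hcard).ge
  have he : ∀ j, e j = S.frame b j x := fun j => by simp [e]
  have := e.sum_repr' v
  simp only [he] at this
  simpa [real_inner_comm] using this

/-- The function `N` may be computed in any frame of the spin structure. -/
lemma SpinorField.N_eq (ψ : SpinorField S ρ) {a : κ} {x : M} (hx : x ∈ S.U a) :
    ψ.N x = ‖ψ.rep a x‖ ^ 2 := by
  have hab : x ∈ S.U a ∩ S.U (S.indexAt x) := ⟨hx, (S.cover x).choose_spec⟩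
  rw [SpinorField.N, ← inner_self_eq_norm_sq (𝕜 := ℂ), ← inner_self_eq_norm_sq (𝕜 := ℂ),
    ψ.inner_rep hab, ← ψ.compat _ _ x hab]

/-- The vector field `X` may be computed in any frame of the spin structure. -/
lemma SpinorField.X_eq (ψ : SpinorField S ρ) {a : κ} {x : M} (hx : x ∈ S.U a) :
    ψ.X x = ∑ i, Xcomp ρ (ψ.rep a x) i • S.frame a i x := by
  have hb : x ∈ S.U (S.indexAt x) := (S.cover x).choose_spec
  simp only [SpinorField.X, ψ.Xcomp_rep ⟨hx, hb⟩, Finset.sum_smul]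
  rw [Finset.sum_comm]
  refine Finset.sum_congr rfl fun i _ => ?_
  conv_rhs => rw [← S.sum_frame hb (S.frame a i x), Finset.smul_sum]
  exact Finset.sum_congr rfl fun j _ => by rw [smul_smul, mul_comm]

/-- The vector field `Y` may be computed in any frame of the spin structure. -/
lemma SpinorField.Y_eq (ψ : SpinorField S ρ) {a : κ} {x : M} (hx : x ∈ S.U a) :
    ψ.Y x = ∑ i, Ycomp ρ (ψ.rep a x) i • S.frame a i x := by
  have hb : x ∈ S.U (S.indexAt x) := (S.cover x).choose_spec
  simp only [SpinorField.Y, ψ.Ycomp_rep ⟨hx, hb⟩, Finset.sum_smul]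
  rw [Finset.sum_comm]
  refine Finset.sum_congr rfl fun i _ => ?_
  conv_rhs => rw [← S.sum_frame hb (S.frame a i x), Finset.smul_sum]
  exact Finset.sum_congr rfl fun j _ => by rw [smul_smul, mul_comm]

/-- The two-form `ω` may be computed in any frame of the spin structure. -/
lemma SpinorField.omega_eq (ψ : SpinorField S ρ) {a : κ} {x : M} (hx : x ∈ S.U a)
    (v w : TangentSpace (model n) x) :
    ψ.omega x v w = ∑ i, ∑ j, omegaComp ρ (ψ.rep a x) i j *
      inner ℝ (S.frame a i x) v * inner ℝ (S.frame a j x) w := by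
  have hb : x ∈ S.U (S.indexAt x) := (S.cover x).choose_spec
  have hinner : ∀ (p : Fin n) (z : TangentSpace (model n) x),
      inner ℝ (S.frame a p x) z = ∑ i, inner ℝ (S.frame a p x) (S.frame (S.indexAt x) i x) *
        inner ℝ (S.frame (S.indexAt x) i x) z := by
    intro p z
    conv_lhs => rw [← S.sum_frame hb (S.frame a p x), sum_inner]
    simp [inner_smul_left]
  have key : ∀ (A O : Fin n → Fin n → ℝ) (r s : Fin n → ℝ),
      ∑ i, ∑ j, (∑ p, ∑ q, A p i * (A q j * O p q)) * r i * s j =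
        ∑ p, ∑ q, O p q * (∑ i, A p i * r i) * (∑ j, A q j * s j) := by
    intro A O r s
    calc _ = ∑ i, ∑ j, ∑ p, ∑ q, O p q * (A p i * r i) * (A q j * s j) := by
          simp only [Finset.sum_mul]
          refine Finset.sum_congr rfl fun i _ => Finset.sum_congr rfl fun j _ =>
            Finset.sum_congr rfl fun p _ => Finset.sum_congr rfl fun q _ => by ring
      _ = ∑ p, ∑ i, ∑ j, ∑ q, O p q * (A p i * r i) * (A q j * s j) := by
          exact (Finset.sum_congr rfl fun i _ => Finset.sum_comm).trans Finset.sum_comm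
      _ = ∑ p, ∑ q, ∑ i, ∑ j, O p q * (A p i * r i) * (A q j * s j) := by
          refine Finset.sum_congr rfl fun p _ => ?_
          exact (Finset.sum_congr rfl fun i _ => Finset.sum_comm).trans Finset.sum_comm
      _ = _ := by
          simp only [Finset.sum_mul, Finset.mul_sum]
          exact Finset.sum_congr rfl fun p _ => Finset.sum_congr rfl fun q _ => Finset.sum_comm
  simp only [SpinorField.omega, ψ.omegaComp_rep ⟨hx, hb⟩]
  rw [key]
  refine Finset.sum_congr rfl fun p _ => Finset.sum_congr rfl fun q _ => ?_
  rw [← hinner p v, ← hinner q w]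

end Independence

/-- The covariant derivative of a two-tensor `τ`, in the direction `u`, evaluated on vector fields:
`(∇_u τ)(V, W) = ∂_u (τ(V, W)) - τ(∇_u V, W) - τ(V, ∇_u W)`. -/
def covDeriv₂
    (D : CovariantDerivative (model n) (EuclideanSpace ℝ (Fin n))
      (fun x : M => TangentSpace (model n) x))
    (τ : (x : M) → TangentSpace (model n) x → TangentSpace (model n) x → ℝ)
    (V W : (x : M) → TangentSpace (model n) x) (x : M) (u : TangentSpace (model n) x) : ℝ :=
  mvfderiv (model n) (fun y => τ y (V y) (W y)) x u - τ x (D V x u) (W x) - τ x (V x) (D W x u)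

end KillingBilinears

end

/-!
At each point the endomorphisms `e_i e_0`, `𝐢 e_i` and `e_i e_j e_0`, whose expectation values in
`ψ` are `X`, `Y` and `ω`, have as covariant derivatives the same expressions in the covariant
derivatives of the vector fields: the spin connection acts on endomorphisms by commutators, and
these reproduce the Levi-Civita connection. The Killing equation reads `∇_u ψ = -½ T_u ψ` with the
self-adjoint endomorphism `T_u = k(u, e_j) e_j e_0 + 𝐢 u`, so that
`∇_u ⟨Q ψ, ψ⟩ = ⟨(∇_u Q) ψ, ψ⟩ - ½ ⟨(Q T_u + T_u Q) ψ, ψ⟩`, and the first-order system amounts to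
computing three anticommutators in the Clifford algebra.

Along a Killing spinor the derivative of `N² - |X|² - |Y|²` in the direction `u` is
`-2 ω(u, X) - 2 ω(Y, k(u, ·))`, and that of `½ |ω|²` is the opposite: the connection terms in the
latter cancel because the connection matrix of an orthonormal frame is skew.
-/

noncomputable section

namespace KillingBilinears

section Calculus

variable {E : Type*} [NormedAddCommGroup E] [NormedSpace ℝ E] {H : Type*} [TopologicalSpace H]
  {I : ModelWithCorners ℝ E H} {M : Type*} [TopologicalSpace M] [ChartedSpace H M]
  {V W G : Type*} [NormedAddCommGroup V] [NormedSpace ℝ V] [NormedAddCommGroup W]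
  [NormedSpace ℝ W] [NormedAddCommGroup G] [NormedSpace ℝ G]

/-- The function `f` is differentiable at `x`, with derivative `f' u` in the direction `u`. Here
`f'` is a bare function, so that formulas for it need not be bundled as continuous linear maps. -/
def HasDirDerivAt (I : ModelWithCorners ℝ E H) (f : M → V) (x : M)
    (f' : TangentSpace I x → V) : Prop :=
  MDifferentiableAt I 𝓘(ℝ, V) f x ∧ ∀ u, mvfderiv I f x u = f' u

namespace HasDirDerivAt

variable {f : M → V} {g : M → W} {x : M} {f' : TangentSpace I x → V} {g' : TangentSpace I x → W}

lemma const (c : V) (x : M) : HasDirDerivAt I (fun _ => c) x fun _ => 0 :=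
  ⟨mdifferentiableAt_const, fun u => by rw [mvfderiv_const]; rfl⟩

lemma congr_deriv {f'' : TangentSpace I x → V} (hf : HasDirDerivAt I f x f')
    (h : ∀ u, f' u = f'' u) : HasDirDerivAt I f x f'' :=
  ⟨hf.1, fun u => (hf.2 u).trans (h u)⟩

lemma unique {f'' : TangentSpace I x → V} (hf : HasDirDerivAt I f x f')
    (hf' : HasDirDerivAt I f x f'') (u : TangentSpace I x) : f' u = f'' u :=
  (hf.2 u).symm.trans (hf'.2 u)

lemma congr_of_eventuallyEq {f₁ : M → V} (hf : HasDirDerivAt I f x f') (h : f₁ =ᶠ[nhds x] f) :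
    HasDirDerivAt I f₁ x f' := by
  refine ⟨hf.1.congr_of_eventuallyEq h, fun u => ?_⟩
  rw [← hf.2 u]
  change mfderiv I 𝓘(ℝ, V) f₁ x u = mfderiv I 𝓘(ℝ, V) f x u
  rw [h.mfderiv_eq]
  rfl

lemma comp_hasFDerivAt {Q : V → W} {Q' : V →L[ℝ] W} (hf : HasDirDerivAt I f x f')
    (hQ : HasFDerivAt Q Q' (f x)) :
    HasDirDerivAt I (fun y => Q (f y)) x fun u => Q' (f' u) := by
  have h := hQ.hasMFDerivAt.comp x hf.1.hasMFDerivAt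
  refine ⟨h.mdifferentiableAt, fun u => ?_⟩
  simp only [← hf.2 u]
  change mfderiv I 𝓘(ℝ, W) (Q ∘ f) x u = _
  rw [h.mfderiv]
  rfl

lemma clm_apply (L : V →L[ℝ] W) (hf : HasDirDerivAt I f x f') :
    HasDirDerivAt I (fun y => L (f y)) x fun u => L (f' u) :=
  hf.comp_hasFDerivAt L.hasFDerivAt

lemma prodMk (hf : HasDirDerivAt I f x f') (hg : HasDirDerivAt I g x g') :
    HasDirDerivAt I (fun y => (f y, g y)) x fun u => (f' u, g' u) := by
  have h : HasMFDerivAt I 𝓘(ℝ, V × W) (fun y => (f y, g y)) x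
      ((mfderiv I 𝓘(ℝ, V) f x : TangentSpace I x →L[ℝ] V).prod (mfderiv I 𝓘(ℝ, W) g x)) :=
    ⟨hf.1.continuousAt.prodMk hg.1.continuousAt,
      hf.1.hasMFDerivAt.2.prodMk hg.1.hasMFDerivAt.2⟩
  refine ⟨h.mdifferentiableAt, fun u => ?_⟩
  simp only [← hf.2 u, ← hg.2 u]
  change mfderiv I 𝓘(ℝ, V × W) (fun y => (f y, g y)) x u = _
  rw [h.mfderiv]
  rfl

lemma bilinear {B : V × W → G} (hB : IsBoundedBilinearMap ℝ B) (hf : HasDirDerivAt I f x f')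
    (hg : HasDirDerivAt I g x g') :
    HasDirDerivAt I (fun y => B (f y, g y)) x fun u => B (f x, g' u) + B (f' u, g x) :=
  (hf.prodMk hg).comp_hasFDerivAt (hB.hasFDerivAt _)

lemma add {g : M → V} {g' : TangentSpace I x → V} (hf : HasDirDerivAt I f x f')
    (hg : HasDirDerivAt I g x g') :
    HasDirDerivAt I (fun y => f y + g y) x fun u => f' u + g' u :=
  (hf.prodMk hg).clm_apply (ContinuousLinearMap.fst ℝ V V + ContinuousLinearMap.snd ℝ V V)

lemma sub {g : M → V} {g' : TangentSpace I x → V} (hf : HasDirDerivAt I f x f')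
    (hg : HasDirDerivAt I g x g') :
    HasDirDerivAt I (fun y => f y - g y) x fun u => f' u - g' u :=
  (hf.prodMk hg).clm_apply (ContinuousLinearMap.fst ℝ V V - ContinuousLinearMap.snd ℝ V V)

lemma sum {ι : Type*} (s : Finset ι) {f : ι → M → V} {f' : ι → TangentSpace I x → V}
    (hf : ∀ i ∈ s, HasDirDerivAt I (f i) x (f' i)) :
    HasDirDerivAt I (fun y => ∑ i ∈ s, f i y) x fun u => ∑ i ∈ s, f' i u := by
  classical
  induction s using Finset.induction_on with
  | empty => simpa only [Finset.sum_empty] using const 0 x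
  | insert i s hi ih =>
    simpa only [Finset.sum_insert hi] using (hf i (Finset.mem_insert_self i s)).add
      (ih fun j hj => hf j (Finset.mem_insert_of_mem hj))

lemma sq {f : M → ℝ} {f' : TangentSpace I x → ℝ} (hf : HasDirDerivAt I f x f') :
    HasDirDerivAt I (fun y => f y ^ 2) x fun u => 2 * f x * f' u :=
  (hf.comp_hasFDerivAt (hasDerivAt_pow 2 (f x)).hasFDerivAt).congr_deriv fun u => by
    simp [mul_comm]

lemma const_mul {f : M → ℝ} {f' : TangentSpace I x → ℝ} (r : ℝ) (hf : HasDirDerivAt I f x f') :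
    HasDirDerivAt I (fun y => r * f y) x fun u => r * f' u :=
  hf.clm_apply (ContinuousLinearMap.mul ℝ ℝ r)

lemma smul_const {f : M → ℝ} {f' : TangentSpace I x → ℝ} (hf : HasDirDerivAt I f x f') (v : V) :
    HasDirDerivAt I (fun y => f y • v) x fun u => f' u • v :=
  hf.clm_apply (ContinuousLinearMap.toSpanSingleton ℝ v)

end HasDirDerivAt

section Constant

variable [IsManifold I 1 M] [I.Boundaryless] {f : M → V}

lemma hasFDerivAt_comp_extChartAt_symm (hf : ∀ x, HasDirDerivAt I f x fun _ => 0) (x : M) {z : E}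
    (hz : z ∈ (extChartAt I x).target) :
    HasFDerivAt (f ∘ (extChartAt I x).symm) (0 : E →L[ℝ] V) z := by
  have hsymm : MDifferentiableAt 𝓘(ℝ, E) I (extChartAt I x).symm z :=
    ((contMDiffOn_extChartAt_symm (n := 1) x).contMDiffAt
      ((isOpen_extChartAt_target x).mem_nhds hz)).mdifferentiableAt one_ne_zero
  refine (((hf _).1.hasMFDerivAt.comp z hsymm.hasMFDerivAt).hasFDerivAt).congr_fderiv ?_
  ext v
  exact (hf _).2 _

lemma isLocallyConstant_of_hasDirDerivAt_zero (hf : ∀ x, HasDirDerivAt I f x fun _ => 0) :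
    IsLocallyConstant f := by
  rw [IsLocallyConstant.iff_eventually_eq]
  intro x
  obtain ⟨r, hr, hball⟩ :=
    Metric.isOpen_iff.mp (isOpen_extChartAt_target x) _ (mem_extChartAt_target (I := I) x)
  have hderiv z (hz : z ∈ Metric.ball (extChartAt I x x) r) :=
    hasFDerivAt_comp_extChartAt_symm hf x (hball hz)
  filter_upwards [(continuousAt_extChartAt (I := I) x).preimage_mem_nhds
    (Metric.ball_mem_nhds _ hr), extChartAt_source_mem_nhds (I := I) x] with y hy hys
  have hconst := Metric.isOpen_ball.is_const_of_fderiv_eq_zero (convex_ball _ _).isPreconnected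
    (fun z hz => (hderiv z hz).differentiableAt.differentiableWithinAt)
    (fun z hz => (hderiv z hz).fderiv) hy (Metric.mem_ball_self hr)
  rwa [Function.comp_apply, Function.comp_apply, (extChartAt I x).left_inv hys,
    extChartAt_to_inv] at hconst

lemma exists_eq_const_of_hasDirDerivAt_zero [ConnectedSpace M]
    (hf : ∀ x, HasDirDerivAt I f x fun _ => 0) : ∃ c, ∀ x, f x = c :=
  ⟨f (Classical.arbitrary M), fun _ =>
    (isLocallyConstant_of_hasDirDerivAt_zero hf).apply_eq_of_isPreconnected
      isPreconnected_univ trivial trivial⟩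

end Constant

end Calculus

section CliffordRelations

/-- Clifford multiplication `c` by the vectors of a Euclidean space `F`, together with the Clifford
multiplication `e₀` by an additional vector of square `1` orthogonal to `F`. -/
structure IsSpacetimeClifford {F R : Type*} [NormedAddCommGroup F] [InnerProductSpace ℝ F] [Ring R]
    [Algebra ℂ R] (c : F → R) (e₀ : R) : Prop where
  mul_add_mul : ∀ v w, c v * c w + c w * c v = -((2 * inner ℝ v w : ℝ) : ℂ) • (1 : R)
  normal_mul : ∀ v, e₀ * c v = -(c v * e₀)
  normal_mul_self : e₀ * e₀ = 1

/-- The operator `c(v) e₀ + 𝐢 c(u)`: with `v_j = k(u, e_j)`, the Killing equation in the direction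
`u` is `∇_u ψ = -½ (c(v) e₀ + 𝐢 c(u)) ψ`. -/
def killingOp {F R : Type*} [Ring R] [Algebra ℂ R] (c : F → R) (e₀ : R) (v u : F) : R :=
  c v * e₀ + Complex.I • c u

namespace IsSpacetimeClifford

variable {F R : Type*} [NormedAddCommGroup F] [InnerProductSpace ℝ F] [Ring R] [Algebra ℂ R]
  {c : F → R} {e₀ : R}

lemma mul_mul_sub (hc : IsSpacetimeClifford c e₀) (u v w : F) :
    c u * (c v * c w) - c v * c w * c u =
      ((2 * inner ℝ u w : ℝ) : ℂ) • c v - ((2 * inner ℝ u v : ℝ) : ℂ) • c w := by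
  calc c u * (c v * c w) - c v * c w * c u
      = (c u * c v + c v * c u) * c w - c v * (c u * c w + c w * c u) := by noncomm_ring
    _ = _ := by
      rw [hc.mul_add_mul, hc.mul_add_mul, smul_mul_assoc, mul_smul_comm, one_mul, mul_one]
      module

lemma normal_mul_mul (hc : IsSpacetimeClifford c e₀) (w z : F) :
    e₀ * (c w * c z) = c w * c z * e₀ := by
  rw [← mul_assoc, hc.normal_mul, neg_mul, mul_assoc, hc.normal_mul, mul_neg, neg_neg, mul_assoc]

lemma mul_normal_mul_mul_normal (hc : IsSpacetimeClifford c e₀) (a : R) (w : F) :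
    a * e₀ * (c w * e₀) = -(a * c w) := by
  rw [mul_assoc, ← mul_assoc e₀, hc.normal_mul, neg_mul, mul_assoc (c w), hc.normal_mul_self,
    mul_one, mul_neg]

lemma mul_normal_anticomm_killingOp (hc : IsSpacetimeClifford c e₀) (w v u : F) :
    c w * e₀ * killingOp c e₀ v u + killingOp c e₀ v u * (c w * e₀) =
      ((2 * inner ℝ v w : ℝ) : ℂ) • (1 : R)
        + Complex.I • (c u * c w * e₀ - c w * c u * e₀) := by
  calc _ = (c w * e₀ * (c v * e₀) + c v * e₀ * (c w * e₀))
        + Complex.I • (c w * (e₀ * c u) + c u * (c w * e₀)) := by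
        simp only [killingOp, mul_add, add_mul, mul_smul_comm, smul_mul_assoc, smul_add, mul_assoc]
        abel
    _ = -(c v * c w + c w * c v) + Complex.I • (c u * c w * e₀ - c w * c u * e₀) := by
        rw [hc.mul_normal_mul_mul_normal, hc.mul_normal_mul_mul_normal, hc.normal_mul]
        noncomm_ring
    _ = _ := by rw [hc.mul_add_mul]; module

lemma smul_anticomm_killingOp (hc : IsSpacetimeClifford c e₀) (w v u : F) :
    Complex.I • c w * killingOp c e₀ v u + killingOp c e₀ v u * Complex.I • c w =
      ((2 * inner ℝ u w : ℝ) : ℂ) • (1 : R)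
        + Complex.I • (c w * c v * e₀ - c v * c w * e₀) := by
  calc _ = Complex.I • (c w * c v * e₀ + c v * (e₀ * c w))
        + (Complex.I * Complex.I) • (c u * c w + c w * c u) := by
        simp only [killingOp, mul_add, add_mul, mul_smul_comm, smul_mul_assoc, smul_add, mul_assoc,
          mul_smul]
        abel
    _ = _ := by
        rw [hc.mul_add_mul, hc.normal_mul, Complex.I_mul_I, mul_neg, ← mul_assoc, ← sub_eq_add_neg]
        module

lemma mul_mul_normal_anticomm_killingOp (hc : IsSpacetimeClifford c e₀) (w z v u : F) :
    c w * c z * e₀ * killingOp c e₀ v u + killingOp c e₀ v u * (c w * c z * e₀) =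
      ((2 * inner ℝ v z : ℝ) : ℂ) • c w - ((2 * inner ℝ v w : ℝ) : ℂ) • c z
        + Complex.I • (((2 * inner ℝ u z : ℝ) : ℂ) • (c w * e₀)
          - ((2 * inner ℝ u w : ℝ) : ℂ) • (c z * e₀)) := by
  calc _ = (c w * c z * e₀ * (c v * e₀) + c v * e₀ * (c w * c z * e₀))
        + Complex.I • (c w * c z * (e₀ * c u) + c u * (c w * c z) * e₀) := by
        simp only [killingOp, mul_add, add_mul, mul_smul_comm, smul_mul_assoc, smul_add, mul_assoc]
        abel
    _ = (c v * (c w * c z) - c w * c z * c v)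
        + Complex.I • ((c u * (c w * c z) - c w * c z * c u) * e₀) := by
        have hv : c v * e₀ * (c w * c z * e₀) = c v * (c w * c z) := by
          rw [← hc.normal_mul_mul, mul_assoc, ← mul_assoc e₀ e₀, hc.normal_mul_self, one_mul]
        rw [hc.mul_normal_mul_mul_normal, hv, hc.normal_mul]
        noncomm_ring
    _ = _ := by
        rw [hc.mul_mul_sub, hc.mul_mul_sub, sub_mul, smul_mul_assoc, smul_mul_assoc]

end IsSpacetimeClifford

end CliffordRelations

section SkewFrame

variable {F ι : Type*} [NormedAddCommGroup F] [InnerProductSpace ℝ F] [Fintype ι]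
  {e : OrthonormalBasis ι ℝ F} {A : ι → F}

lemma sum_inner_smul_eq_neg (hA : ∀ i j, inner ℝ (A i) (e j) = -inner ℝ (e i) (A j)) (v : F) :
    ∑ i, inner ℝ v (e i) • A i = -∑ i, inner ℝ v (A i) • e i := by
  refine InnerProductSpace.ext_inner_right_basis e.toBasis fun j => ?_
  calc inner ℝ (∑ i, inner ℝ v (e i) • A i) (e.toBasis j)
      = -∑ i, inner ℝ v (e i) * inner ℝ (e i) (A j) := by
        simp [sum_inner, real_inner_smul_left, hA]
    _ = inner ℝ (-∑ i, inner ℝ v (A i) • e i) (e.toBasis j) := by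
        classical
        simp [e.sum_inner_mul_inner, sum_inner, real_inner_smul_left, e.inner_eq_ite]

lemma sum_bilin_skew {G : Type*} [AddCommGroup G] [Module ℝ G] (B : F →ₗ[ℝ] F →ₗ[ℝ] G)
    (hA : ∀ i j, inner ℝ (A i) (e j) = -inner ℝ (e i) (A j)) :
    ∑ i, B (A i) (e i) = -∑ i, B (e i) (A i) := by
  have hsum i : A i = ∑ j, inner ℝ (e j) (A i) • e j := (e.sum_repr' _).symm
  calc ∑ i, B (A i) (e i)
      = ∑ i, ∑ j, inner ℝ (e j) (A i) • B (e j) (e i) := by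
        refine Finset.sum_congr rfl fun i _ => ?_
        conv_lhs => rw [hsum i]
        simp only [map_sum, map_smul, LinearMap.sum_apply, LinearMap.smul_apply]
    _ = ∑ j, ∑ i, inner ℝ (e j) (A i) • B (e j) (e i) := Finset.sum_comm
    _ = -∑ j, B (e j) (A j) := by
        rw [← Finset.sum_neg_distrib]
        refine Finset.sum_congr rfl fun j _ => ?_
        conv_rhs => rw [hsum j]
        simp only [map_sum, map_smul, ← Finset.sum_neg_distrib, ← neg_smul]
        exact Finset.sum_congr rfl fun i _ => by rw [← hA, real_inner_comm]

lemma sum_symm_bilin_skew {B : F →ₗ[ℝ] F →ₗ[ℝ] ℝ} (hB : ∀ v w, B v w = B w v)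
    (hA : ∀ i j, inner ℝ (A i) (e j) = -inner ℝ (e i) (A j)) : ∑ i, B (e i) (A i) = 0 := by
  have h := sum_bilin_skew B hA
  simp only [hB (A _)] at h
  linarith

lemma sum_sum_bilin_mul_skew (B : LinearMap.BilinForm ℝ F)
    (hA : ∀ i j, inner ℝ (A i) (e j) = -inner ℝ (e i) (A j)) :
    ∑ i, ∑ j, B (e i) (e j) * B (A i) (e j) = 0 := by
  let G : LinearMap.BilinForm ℝ F :=
    ∑ j, LinearMap.BilinForm.linMulLin (B.flip (e j)) (B.flip (e j))
  have hG v w : G v w = ∑ j, B v (e j) * B w (e j) := by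
    simp [G, LinearMap.sum_apply]
  have hsymm v w : G v w = G w v := by
    simp only [hG, mul_comm]
  simpa only [hG] using sum_symm_bilin_skew hsymm hA

lemma sum_sum_bilin_mul_inner_mul_inner (B : LinearMap.BilinForm ℝ F) (e : OrthonormalBasis ι ℝ F)
    (v w : F) : ∑ i, ∑ j, B (e i) (e j) * (inner ℝ v (e i) * inner ℝ w (e j)) = B v w := by
  conv_rhs => rw [← e.sum_repr' v, ← e.sum_repr' w]
  simp only [map_sum, map_smul, LinearMap.sum_apply, LinearMap.smul_apply, smul_eq_mul,
    Finset.mul_sum]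
  rw [Finset.sum_comm]
  refine Finset.sum_congr rfl fun i _ => Finset.sum_congr rfl fun j _ => ?_
  rw [real_inner_comm v, real_inner_comm w]
  ring

lemma sum_sum_bilin_mul_skew_add_wedge {B : LinearMap.BilinForm ℝ F} (hB : ∀ v w, B v w = -B w v)
    (hA : ∀ i j, inner ℝ (A i) (e j) = -inner ℝ (e i) (A j)) (u v w z : F) :
    ∑ i, ∑ j, 2 * B (e i) (e j) * (B (A i) (e j) + B (e i) (A j) +
      (inner ℝ u (e i) * inner ℝ w (e j) - inner ℝ u (e j) * inner ℝ w (e i)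
        - inner ℝ v (e i) * inner ℝ z (e j) + inner ℝ v (e j) * inner ℝ z (e i))) =
      4 * (B u w + B z v) := by
  have hleft : ∑ i, ∑ j, B (e i) (e j) * B (A i) (e j) = 0 := sum_sum_bilin_mul_skew B hA
  have hright : ∑ i, ∑ j, B (e i) (e j) * B (e i) (A j) = 0 := by
    rw [Finset.sum_comm]
    exact sum_sum_bilin_mul_skew B.flip hA
  calc _ = 2 * (∑ i, ∑ j, B (e i) (e j) * B (A i) (e j) + ∑ i, ∑ j, B (e i) (e j) * B (e i) (A j))
        + 2 * (B u w - B w u - B v z + B z v) := by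
        have hsum := sum_sum_bilin_mul_inner_mul_inner B e
        rw [← hsum u w, ← hsum w u, ← hsum v z, ← hsum z v]
        simp only [Finset.mul_sum, ← Finset.sum_add_distrib, ← Finset.sum_sub_distrib]
        exact Finset.sum_congr rfl fun i _ => Finset.sum_congr rfl fun j _ => by ring
    _ = _ := by
        rw [hleft, hright, hB w, hB v]
        ring

lemma sum_sq_linear_eq {ι' : Type*} [Fintype ι'] (α : F →ₗ[ℝ] ℝ) (e : OrthonormalBasis ι ℝ F)
    (f : OrthonormalBasis ι' ℝ F) : ∑ i, α (e i) ^ 2 = ∑ i, α (f i) ^ 2 := by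
  let z := ∑ i, α (e i) • e i
  have hα v : α v = inner ℝ v z := by
    conv_lhs => rw [← e.sum_repr' v]
    simp [z, inner_sum, real_inner_smul_right, real_inner_comm, mul_comm]
  have he := e.sum_sq_norm_inner_right z
  have hf := f.sum_sq_norm_inner_right z
  simp only [← hα, Real.norm_eq_abs, sq_abs] at he hf
  rw [he, hf]

lemma sum_sum_sq_bilin_eq {ι' : Type*} [Fintype ι'] (B : LinearMap.BilinForm ℝ F)
    (e : OrthonormalBasis ι ℝ F) (f : OrthonormalBasis ι' ℝ F) :
    ∑ i, ∑ j, B (e i) (e j) ^ 2 = ∑ i, ∑ j, B (f i) (f j) ^ 2 := by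
  calc ∑ i, ∑ j, B (e i) (e j) ^ 2
      = ∑ i, ∑ j, B (e i) (f j) ^ 2 :=
        Finset.sum_congr rfl fun i _ => sum_sq_linear_eq (B (e i)) e f
    _ = ∑ j, ∑ i, B (e i) (f j) ^ 2 := Finset.sum_comm
    _ = ∑ j, ∑ i, B (f i) (f j) ^ 2 :=
        Finset.sum_congr rfl fun j _ => sum_sq_linear_eq (B.flip (f j)) e f
    _ = ∑ i, ∑ j, B (f i) (f j) ^ 2 := Finset.sum_comm

variable {R : Type*} [Ring R] [Algebra ℂ R] {c : F →ₗ[ℝ] R}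

/-- The action on spinors of the skew endomorphism `e_i ↦ A_i`, for Clifford multiplication `c`. -/
def spinOp (c : F →ₗ[ℝ] R) (e A : ι → F) : R :=
  (1 / 4 : ℂ) • ∑ i, c (e i) * c (A i)

lemma spinOp_add (e A A' : ι → F) :
    spinOp c e (fun i => A i + A' i) = spinOp c e A + spinOp c e A' := by
  simp only [spinOp, map_add, mul_add, Finset.sum_add_distrib, smul_add]

lemma spinOp_smul (r : ℝ) (e A : ι → F) : spinOp c e (fun i => r • A i) = r • spinOp c e A := by
  simp only [spinOp, map_smul, mul_smul_comm, ← Finset.smul_sum]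
  rw [smul_comm]

lemma killingOp_add (e₀ : R) (v v' u u' : F) :
    killingOp c e₀ (v + v') (u + u') = killingOp c e₀ v u + killingOp c e₀ v' u' := by
  simp only [killingOp, map_add, add_mul, smul_add]
  abel

lemma killingOp_smul (e₀ : R) (r : ℝ) (v u : F) :
    killingOp c e₀ (r • v) (r • u) = r • killingOp c e₀ v u := by
  simp only [killingOp, map_smul, smul_mul_assoc, smul_add]
  rw [smul_comm]

namespace IsSpacetimeClifford

variable {e₀ : R}

lemma spinOp_commutator (hc : IsSpacetimeClifford c e₀)
    (hA : ∀ i j, inner ℝ (A i) (e j) = -inner ℝ (e i) (A j)) (v : F) :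
    spinOp c e A * c v - c v * spinOp c e A = -∑ i, inner ℝ v (A i) • c (e i) := by
  have hcA : ∑ i, inner ℝ v (e i) • c (A i) = -∑ i, inner ℝ v (A i) • c (e i) := by
    simpa only [map_sum, map_smul, map_neg] using congrArg c (sum_inner_smul_eq_neg hA v)
  calc spinOp c e A * c v - c v * spinOp c e A
      = -((1 / 4 : ℂ) • ∑ i, (c v * (c (e i) * c (A i)) - c (e i) * c (A i) * c v)) := by
        rw [spinOp, smul_mul_assoc, mul_smul_comm, ← smul_sub, Finset.sum_mul, Finset.mul_sum,
          Finset.sum_sub_distrib, ← smul_neg, neg_sub]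
    _ = (1 / 2 : ℂ) • (∑ i, inner ℝ v (e i) • c (A i) - ∑ i, inner ℝ v (A i) • c (e i)) := by
        simp only [hc.mul_mul_sub, Finset.sum_sub_distrib, Complex.coe_smul, mul_smul,
          ← Finset.smul_sum]
        module
    _ = -∑ i, inner ℝ v (A i) • c (e i) := by
        rw [hcA]
        module

lemma spinOp_commute_normal (hc : IsSpacetimeClifford c e₀) (e A : ι → F) :
    Commute (spinOp c e A) e₀ := by
  refine Commute.smul_left (Commute.sum_left _ _ _ fun i _ => ?_) _
  exact (hc.normal_mul_mul _ _).symm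

end IsSpacetimeClifford

end SkewFrame

section HermitianClifford

/-- The relations of `IsSpacetimeClifford` for operators on a Hermitian space on which the vectors
of `F` act by skew-adjoint operators and the additional vector by a self-adjoint one. -/
structure IsHermitianClifford {F H : Type*} [NormedAddCommGroup F] [InnerProductSpace ℝ F]
    [NormedAddCommGroup H] [InnerProductSpace ℂ H] (c : F → H →L[ℂ] H) (e₀ : H →L[ℂ] H) : Prop
    extends IsSpacetimeClifford c e₀ where
  inner_vector : ∀ v φ χ, inner ℂ (c v φ) χ = -inner ℂ φ (c v χ)
  inner_normal : ∀ φ χ, inner ℂ (e₀ φ) χ = inner ℂ φ (e₀ χ)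

variable {F H : Type*} [NormedAddCommGroup F] [InnerProductSpace ℝ F] [NormedAddCommGroup H]
  [InnerProductSpace ℂ H] {c : F →ₗ[ℝ] H →L[ℂ] H} {e₀ : H →L[ℂ] H}

lemma inner_spinOp {ι : Type*} [Fintype ι] {e : OrthonormalBasis ι ℝ F} {A : ι → F}
    (hc : ∀ v φ χ, inner ℂ (c v φ) χ = -inner ℂ φ (c v χ))
    (hA : ∀ i j, inner ℝ (A i) (e j) = -inner ℝ (e i) (A j)) (φ χ : H) :
    inner ℂ (spinOp c e A φ) χ = -inner ℂ φ (spinOp c e A χ) := by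
  have hadjoint : inner ℂ ((∑ i, c (e i) * c (A i)) φ) χ =
      inner ℂ φ ((∑ i, c (A i) * c (e i)) χ) := by
    simp only [sum_apply, mul_apply_eq_comp, sum_inner, inner_sum, hc, neg_neg]
  have hsum : ∑ i, c (A i) * c (e i) = -∑ i, c (e i) * c (A i) :=
    sum_bilin_skew ((LinearMap.mul ℝ (H →L[ℂ] H)).compl₁₂ c c) hA
  rw [spinOp, smul_apply, smul_apply, inner_smul_left, inner_smul_right, hadjoint,
    hsum, neg_apply, inner_neg_right, mul_neg, map_div₀, map_one, Complex.conj_ofNat]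

/-- The quadratic expression `⟨Q φ, φ⟩` in the spinor `φ`, as a function of the operator `Q`. -/
def expectation (φ : H) : (H →L[ℂ] H) →ₗ[ℂ] ℂ where
  toFun Q := inner ℂ φ (Q φ)
  map_add' _ _ := inner_add_right _ _ _
  map_smul' _ _ := inner_smul_right _ _ _

lemma re_expectation_one (φ : H) : (expectation φ 1).re = ‖φ‖ ^ 2 :=
  inner_self_eq_norm_sq (𝕜 := ℂ) φ

lemma expectation_real_smul (φ : H) (r : ℝ) (Q : H →L[ℂ] H) :
    expectation φ (r • Q) = r * expectation φ Q := by
  rw [← Complex.coe_smul, map_smul, smul_eq_mul]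

lemma expectation_I_smul (φ : H) (Q : H →L[ℂ] H) :
    expectation φ (Complex.I • Q) = Complex.I * expectation φ Q := by
  rw [map_smul, smul_eq_mul]

lemma expectation_sub_half_smul (φ : H) (Q A : H →L[ℂ] H) :
    expectation φ (Q - (1 / 2 : ℂ) • A) =
      expectation φ Q - ((1 / 2 : ℝ) : ℂ) * expectation φ A := by
  rw [map_sub, map_smul, smul_eq_mul]
  norm_num

/-- The linear form `⟨X, ·⟩` of the spinor `φ`, for Clifford multiplications `c` and `e₀`. -/
def xForm (c : F →ₗ[ℝ] H →L[ℂ] H) (e₀ : H →L[ℂ] H) (φ : H) : F →ₗ[ℝ] ℝ where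
  toFun v := (expectation φ (c v * e₀)).re
  map_add' v w := by rw [map_add, add_mul, map_add, Complex.add_re]
  map_smul' r v := by
    rw [map_smul, smul_mul_assoc, expectation_real_smul, Complex.re_ofReal_mul]
    rfl

/-- The linear form `⟨Y, ·⟩` of the spinor `φ`, for Clifford multiplication `c`. -/
def yForm (c : F →ₗ[ℝ] H →L[ℂ] H) (φ : H) : F →ₗ[ℝ] ℝ where
  toFun v := (expectation φ (Complex.I • c v)).re
  map_add' v w := by rw [map_add, smul_add, map_add, Complex.add_re]
  map_smul' r v := by
    rw [map_smul c, smul_comm, expectation_real_smul, Complex.re_ofReal_mul]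
    rfl

/-- The two-form `ω` of the spinor `φ`, for Clifford multiplications `c` and `e₀`, as a bilinear
form. -/
def omegaForm (c : F →ₗ[ℝ] H →L[ℂ] H) (e₀ : H →L[ℂ] H) (φ : H) : LinearMap.BilinForm ℝ F :=
  LinearMap.mk₂ ℝ (fun v w => (expectation φ (c v * c w * e₀)).im)
    (fun v v' w => by rw [map_add, add_mul, add_mul, map_add, Complex.add_im])
    (fun r v w => by
      rw [map_smul, smul_mul_assoc, smul_mul_assoc, expectation_real_smul, Complex.im_ofReal_mul]
      rfl)
    (fun v w w' => by rw [map_add, mul_add, add_mul, map_add, Complex.add_im])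
    (fun r v w => by
      rw [map_smul, mul_smul_comm, smul_mul_assoc, expectation_real_smul, Complex.im_ofReal_mul]
      rfl)

lemma xForm_apply (φ : H) (v : F) : xForm c e₀ φ v = (expectation φ (c v * e₀)).re := rfl

lemma yForm_apply (φ : H) (v : F) : yForm c φ v = (expectation φ (Complex.I • c v)).re := rfl

lemma omegaForm_apply (φ : H) (v w : F) :
    omegaForm c e₀ φ v w = (expectation φ (c v * c w * e₀)).im := rfl

lemma im_expectation_vector (φ : H) (v : F) : (expectation φ (c v)).im = -yForm c φ v := by
  simp [yForm_apply]

lemma re_expectation_sub_killingOp (Q' : H →L[ℂ] H) (φ : H) (v u : F) :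
    (expectation φ (Q' - (1 / 2 : ℂ) •
      (1 * killingOp c e₀ v u + killingOp c e₀ v u * 1))).re =
      (expectation φ Q').re - xForm c e₀ φ v - yForm c φ u := by
  have h : (1 / 2 : ℂ) • (1 * killingOp c e₀ v u + killingOp c e₀ v u * 1) =
      c v * e₀ + Complex.I • c u := by
    rw [one_mul, mul_one, killingOp]
    module
  rw [h, map_sub, map_add, Complex.sub_re, Complex.add_re, xForm_apply, yForm_apply, sub_sub]

namespace IsHermitianClifford

lemma inner_killingOp (hc : IsHermitianClifford c e₀) (v u : F) (φ χ : H) :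
    inner ℂ (killingOp c e₀ v u φ) χ = inner ℂ φ (killingOp c e₀ v u χ) := by
  have hanti : e₀ (c v χ) = -c v (e₀ χ) := congrArg (· χ) (hc.normal_mul v)
  simp [killingOp, hc.inner_vector, hc.inner_normal, hanti, mul_comm]

lemma im_expectation_normal (hc : IsHermitianClifford c e₀) (φ : H) : (expectation φ e₀).im = 0 :=
  Complex.conj_eq_iff_im.1 ((inner_conj_symm _ _).trans (hc.inner_normal φ φ))

lemma omegaForm_antisymm (hc : IsHermitianClifford c e₀) (φ : H) (v w : F) :
    omegaForm c e₀ φ v w = -omegaForm c e₀ φ w v := by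
  rw [eq_neg_iff_add_eq_zero, omegaForm_apply, omegaForm_apply, ← Complex.add_im, ← map_add,
    ← add_mul, hc.mul_add_mul, smul_mul_assoc, one_mul, map_smul, smul_eq_mul,
    ← Complex.ofReal_neg, Complex.im_ofReal_mul, hc.im_expectation_normal, mul_zero]

variable (Q' : H →L[ℂ] H) (φ : H) (v u w z : F)

lemma re_expectation_mul_normal_sub_killingOp (hc : IsHermitianClifford c e₀) :
    (expectation φ (Q' - (1 / 2 : ℂ) •
      (c w * e₀ * killingOp c e₀ v u + killingOp c e₀ v u * (c w * e₀)))).re =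
      (expectation φ Q').re - inner ℝ v w * ‖φ‖ ^ 2 + omegaForm c e₀ φ u w := by
  have hanti := hc.omegaForm_antisymm φ w u
  rw [hc.mul_normal_anticomm_killingOp, expectation_sub_half_smul]
  simp only [map_add, map_sub, Complex.coe_smul, expectation_real_smul, expectation_I_smul,
    Complex.sub_re, Complex.add_re, Complex.re_ofReal_mul, Complex.I_mul_re, Complex.sub_im,
    re_expectation_one, omegaForm_apply] at hanti ⊢
  linarith

lemma re_expectation_smul_sub_killingOp (hc : IsHermitianClifford c e₀) :
    (expectation φ (Q' - (1 / 2 : ℂ) •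
      (Complex.I • c w * killingOp c e₀ v u + killingOp c e₀ v u * Complex.I • c w))).re =
      (expectation φ Q').re - inner ℝ u w * ‖φ‖ ^ 2 + omegaForm c e₀ φ w v := by
  have hanti := hc.omegaForm_antisymm φ w v
  rw [hc.smul_anticomm_killingOp, expectation_sub_half_smul]
  simp only [map_add, map_sub, Complex.coe_smul, expectation_real_smul, expectation_I_smul,
    Complex.sub_re, Complex.add_re, Complex.re_ofReal_mul, Complex.I_mul_re, Complex.sub_im,
    re_expectation_one, omegaForm_apply] at hanti ⊢
  linarith

lemma im_expectation_mul_mul_normal_sub_killingOp (hc : IsHermitianClifford c e₀) :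
    (expectation φ (Q' - (1 / 2 : ℂ) •
      (c w * c z * e₀ * killingOp c e₀ v u + killingOp c e₀ v u * (c w * c z * e₀)))).im =
      (expectation φ Q').im + inner ℝ u w * xForm c e₀ φ z - inner ℝ u z * xForm c e₀ φ w
        - inner ℝ v w * yForm c φ z + inner ℝ v z * yForm c φ w := by
  rw [hc.mul_mul_normal_anticomm_killingOp, expectation_sub_half_smul]
  simp only [map_add, map_sub, Complex.coe_smul, expectation_real_smul, expectation_I_smul,
    Complex.sub_im, Complex.add_im, Complex.im_ofReal_mul, Complex.I_mul_im, Complex.sub_re,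
    Complex.re_ofReal_mul, im_expectation_vector, xForm_apply]
  ring

end IsHermitianClifford

end HermitianClifford

section SpinorOperators

variable {n : ℕ} {Δ : Type*} [NormedAddCommGroup Δ] [InnerProductSpace ℂ Δ]

/-- The algebra of endomorphisms of the fibre of the spacetime spinor bundle. -/
abbrev SpacetimeEnd (Δ : Type*) [NormedAddCommGroup Δ] [InnerProductSpace ℂ Δ] : Type _ :=
  Spacetime Δ →L[ℂ] Spacetime Δ

lemma SpinorModule.act_ι_act_ι (ρ : SpinorModule n Δ) (v : EuclideanSpace ℝ (Fin n)) (φ : Δ) :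
    ρ.act (CliffordAlgebra.ι (negForm n) v) (ρ.act (CliffordAlgebra.ι (negForm n) v) φ) =
      -((‖v‖ ^ 2 : ℝ) : ℂ) • φ := by
  rw [← Module.End.mul_apply, ← map_mul, CliffordAlgebra.ι_sq_scalar, AlgHom.commutes,
    Module.algebraMap_end_apply, ← Complex.coe_smul]
  simp [negForm]

lemma SpinorModule.norm_act_ι (ρ : SpinorModule n Δ) (v : EuclideanSpace ℝ (Fin n)) (φ : Δ) :
    ‖ρ.act (CliffordAlgebra.ι (negForm n) v) φ‖ = ‖v‖ * ‖φ‖ := by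
  rw [← sq_eq_sq₀ (norm_nonneg _) (by positivity), mul_pow, ← inner_self_eq_norm_sq (𝕜 := ℂ),
    ρ.skew, ρ.act_ι_act_ι, neg_smul, inner_neg_right, neg_neg, inner_smul_right,
    ← inner_self_eq_norm_sq (𝕜 := ℂ) φ]
  exact Complex.re_ofReal_mul _ _

/-- Clifford multiplication `v (ψ₁, ψ₂) = (v ψ₁, -v ψ₂)` by the vectors of `ℝⁿ` on the fibre of the
spacetime spinor bundle. -/
def vecAct (ρ : SpinorModule n Δ) (v : EuclideanSpace ℝ (Fin n)) (φ : Spacetime Δ) : Spacetime Δ :=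
  WithLp.toLp 2 (ρ.act (CliffordAlgebra.ι (negForm n) v) φ.fst,
    -ρ.act (CliffordAlgebra.ι (negForm n) v) φ.snd)

lemma norm_vecAct (ρ : SpinorModule n Δ) (v : EuclideanSpace ℝ (Fin n)) (φ : Spacetime Δ) :
    ‖vecAct ρ v φ‖ = ‖v‖ * ‖φ‖ := by
  rw [← sq_eq_sq₀ (norm_nonneg _) (by positivity), mul_pow]
  simp only [vecAct, WithLp.prod_norm_sq_eq_of_L2, WithLp.toLp_fst, WithLp.toLp_snd, norm_neg,
    ρ.norm_act_ι]
  ring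

lemma vecAct_add_left (ρ : SpinorModule n Δ) (v w : EuclideanSpace ℝ (Fin n)) (φ : Spacetime Δ) :
    vecAct ρ (v + w) φ = vecAct ρ v φ + vecAct ρ w φ := by
  simp only [vecAct, map_add, LinearMap.add_apply, neg_add, ← WithLp.toLp_add, Prod.mk_add_mk]

lemma vecAct_smul_left (ρ : SpinorModule n Δ) (r : ℝ) (v : EuclideanSpace ℝ (Fin n))
    (φ : Spacetime Δ) : vecAct ρ (r • v) φ = r • vecAct ρ v φ := by
  simp only [vecAct, map_smul, LinearMap.smul_apply, ← smul_neg]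
  rfl

/-- Clifford multiplication by the vectors of `ℝⁿ`, as a linear map into the endomorphisms of the
fibre of the spacetime spinor bundle. -/
def vecOp (ρ : SpinorModule n Δ) : EuclideanSpace ℝ (Fin n) →ₗ[ℝ] SpacetimeEnd Δ where
  toFun v := LinearMap.mkContinuous
    { toFun := vecAct ρ v
      map_add' := fun φ χ => by
        simp [vecAct, ← WithLp.toLp_add, add_comm]
      map_smul' := fun z φ => by simp [vecAct, ← WithLp.toLp_smul] }
    ‖v‖ fun φ => (norm_vecAct ρ v φ).le
  map_add' v w := ContinuousLinearMap.ext fun φ => vecAct_add_left ρ v w φ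
  map_smul' r v := ContinuousLinearMap.ext fun φ => vecAct_smul_left ρ r v φ

/-- Clifford multiplication by `e₀` on the fibre of the spacetime spinor bundle. -/
def normalOp (Δ : Type*) [NormedAddCommGroup Δ] [InnerProductSpace ℂ Δ] : SpacetimeEnd Δ :=
  (LinearIsometryEquiv.withLpProdComm 2 ℂ Δ Δ).toContinuousLinearEquiv

lemma vecOp_single_apply (ρ : SpinorModule n Δ) (i : Fin n) (φ : Spacetime Δ) :
    vecOp ρ (EuclideanSpace.single i 1) φ = cl ρ i φ := rfl

lemma normalOp_apply (φ : Spacetime Δ) : normalOp Δ φ = cl0 φ := rfl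

lemma vecOp_apply (ρ : SpinorModule n Δ) (v : EuclideanSpace ℝ (Fin n)) (φ : Spacetime Δ) :
    vecOp ρ v φ = vecAct ρ v φ := rfl

lemma vecOp_mul_self (ρ : SpinorModule n Δ) (v : EuclideanSpace ℝ (Fin n)) :
    vecOp ρ v * vecOp ρ v = -((‖v‖ ^ 2 : ℝ) : ℂ) • 1 := by
  ext φ : 1
  apply WithLp.ofLp_injective
  ext <;> simp [vecOp_apply, vecAct, ρ.act_ι_act_ι]

lemma isSpacetimeClifford_vecOp (ρ : SpinorModule n Δ) :
    IsSpacetimeClifford (vecOp ρ) (normalOp Δ) where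
  mul_add_mul v w := by
    calc vecOp ρ v * vecOp ρ w + vecOp ρ w * vecOp ρ v
        = vecOp ρ (v + w) * vecOp ρ (v + w) - vecOp ρ v * vecOp ρ v - vecOp ρ w * vecOp ρ w := by
          rw [map_add]
          noncomm_ring
      _ = _ := by
          simp only [vecOp_mul_self, norm_add_sq_real]
          push_cast
          module
  normal_mul v := by
    ext φ : 1
    apply WithLp.ofLp_injective
    ext <;> simp [vecOp_apply, vecAct, normalOp_apply, cl0]
  normal_mul_self := rfl

lemma isHermitianClifford_vecOp (ρ : SpinorModule n Δ) :
    IsHermitianClifford (vecOp ρ) (normalOp Δ) where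
  toIsSpacetimeClifford := isSpacetimeClifford_vecOp ρ
  inner_vector v φ χ := by simp [vecOp_apply, vecAct, ρ.skew, add_comm]
  inner_normal φ χ := by simp [normalOp_apply, cl0, add_comm]

end SpinorOperators

section LocalFrame

variable {n : ℕ} {M : Type*} [TopologicalSpace M] [ChartedSpace (EuclideanSpace ℝ (Fin n)) M]
  [IsManifold (model n) ∞ M] [RiemannianBundle (fun x : M => TangentSpace (model n) x)]
  {κ : Type*}

/-- Differentiability at `x` of the vector field `V`, as a section of the tangent bundle. -/
abbrev MDifferentiableFieldAt (V : (x : M) → TangentSpace (model n) x) (x : M) : Prop :=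
  MDifferentiableAt (model n) ((model n).prod 𝓘(ℝ, EuclideanSpace ℝ (Fin n))) (T% V) x

namespace SpinStructure

variable (S : SpinStructure n M κ) {a : κ} {x : M}

/-- The local frame with index `a` as an orthonormal basis of the tangent space at `x`. -/
def orthonormalBasisAt (hx : x ∈ S.U a) :
    OrthonormalBasis (Fin n) ℝ (TangentSpace (model n) x) :=
  OrthonormalBasis.mk (S.frame_orthonormal a x hx) fun v _ => by
    rw [← S.sum_frame hx v]
    exact Submodule.sum_smul_mem _ _ fun i _ => Submodule.subset_span ⟨i, rfl⟩

@[simp]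
lemma coe_orthonormalBasisAt (hx : x ∈ S.U a) :
    ⇑(S.orthonormalBasisAt hx) = fun i => S.frame a i x :=
  OrthonormalBasis.coe_mk _ _

lemma mdifferentiableAt_frame (hx : x ∈ S.U a) (i : Fin n) :
    MDifferentiableFieldAt (S.frame a i) x :=
  ((S.frame_contMDiffOn a i).contMDiffAt ((S.isOpen a).mem_nhds hx)).mdifferentiableAt one_ne_zero

variable (a x) in
/-- The coordinates of a tangent vector at `x` in the local frame with index `a`. -/
def coord : TangentSpace (model n) x →ₗ[ℝ] EuclideanSpace ℝ (Fin n) where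
  toFun v := WithLp.toLp 2 fun i => inner ℝ (S.frame a i x) v
  map_add' v w := by ext i; simp [inner_add_right]
  map_smul' r v := by ext i; simp [real_inner_smul_right]

lemma coord_eq_sum (v : TangentSpace (model n) x) :
    S.coord a x v = ∑ i, inner ℝ (S.frame a i x) v • EuclideanSpace.single i 1 := by
  ext j
  simp [coord, Pi.single_apply]

lemma inner_coord (hx : x ∈ S.U a) (v w : TangentSpace (model n) x) :
    inner ℝ (S.coord a x v) (S.coord a x w) = inner ℝ v w := by
  have h := (S.orthonormalBasisAt hx).sum_inner_mul_inner v w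
  simpa [coord, PiLp.inner_apply, real_inner_comm, mul_comm] using h

lemma coord_frame (hx : x ∈ S.U a) (i : Fin n) :
    S.coord a x (S.frame a i x) = EuclideanSpace.single i 1 := by
  ext j
  have h := (S.orthonormalBasisAt hx).inner_eq_ite j i
  simpa [coord, Pi.single_apply] using h

variable (a x) in
/-- The tangent vector dual to a linear form, computed in the local frame with index `a`. -/
def sharp : (TangentSpace (model n) x →L[ℝ] ℝ) →ₗ[ℝ] TangentSpace (model n) x where
  toFun α := ∑ i, α (S.frame a i x) • S.frame a i x
  map_add' α β := by simp [add_smul, Finset.sum_add_distrib]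
  map_smul' r α := by simp [mul_smul, Finset.smul_sum]

lemma inner_sharp (hx : x ∈ S.U a) (α : TangentSpace (model n) x →L[ℝ] ℝ)
    (v : TangentSpace (model n) x) : inner ℝ (S.sharp a x α) v = α v := by
  conv_rhs => rw [← S.sum_frame hx v]
  rw [real_inner_comm]
  simp [sharp, inner_sum, real_inner_smul_right, mul_comm]

variable {Δ : Type*} [NormedAddCommGroup Δ] [InnerProductSpace ℂ Δ] (ρ : SpinorModule n Δ)

variable (a x) in
/-- Clifford multiplication by the tangent vectors at `x` on the fibre of the spacetime spinor
bundle, which the local frame with index `a` identifies with `Spacetime Δ`. -/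
def clMul : TangentSpace (model n) x →ₗ[ℝ] SpacetimeEnd Δ :=
  vecOp ρ ∘ₗ S.coord a x

lemma clMul_eq_sum (v : TangentSpace (model n) x) :
    S.clMul a x ρ v = ∑ i, inner ℝ (S.frame a i x) v • vecOp ρ (EuclideanSpace.single i 1) := by
  rw [clMul, LinearMap.comp_apply, coord_eq_sum, map_sum]
  simp only [map_smul]

lemma clMul_frame_apply (hx : x ∈ S.U a) (i : Fin n) (φ : Spacetime Δ) :
    S.clMul a x ρ (S.frame a i x) φ = cl ρ i φ := by
  rw [clMul, LinearMap.comp_apply, S.coord_frame hx, vecOp_single_apply]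

lemma isHermitianClifford_clMul (hx : x ∈ S.U a) :
    IsHermitianClifford (S.clMul a x ρ) (normalOp Δ) where
  mul_add_mul v w := by
    rw [← S.inner_coord hx]
    exact (isHermitianClifford_vecOp ρ).mul_add_mul _ _
  normal_mul v := (isHermitianClifford_vecOp ρ).normal_mul _
  normal_mul_self := (isHermitianClifford_vecOp ρ).normal_mul_self
  inner_vector v := (isHermitianClifford_vecOp ρ).inner_vector _
  inner_normal := (isHermitianClifford_vecOp ρ).inner_normal

end SpinStructure

end LocalFrame

section SpinConnection

variable {n : ℕ} {M : Type*} [TopologicalSpace M] [ChartedSpace (EuclideanSpace ℝ (Fin n)) M]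
  [IsManifold (model n) ∞ M] [RiemannianBundle (fun x : M => TangentSpace (model n) x)]
  {D : CovariantDerivative (model n) (EuclideanSpace ℝ (Fin n))
    (fun x : M => TangentSpace (model n) x)}
  {k : (x : M) → TangentSpace (model n) x →L[ℝ] TangentSpace (model n) x →L[ℝ] ℝ}
  {κ : Type*} {S : SpinStructure n M κ} {a : κ} {x : M}
  {Δ : Type*} [NormedAddCommGroup Δ] [InnerProductSpace ℂ Δ] {ρ : SpinorModule n Δ}

lemma hasDirDerivAt_inner [IsContMDiffRiemannianBundle (model n) 1 (EuclideanSpace ℝ (Fin n))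
      (fun x : M => TangentSpace (model n) x)] (hD : D.IsMetricCompatible)
    {V W : (x : M) → TangentSpace (model n) x}
    (hV : MDifferentiableFieldAt V x) (hW : MDifferentiableFieldAt W x) :
    HasDirDerivAt (model n) (fun y => inner ℝ (V y) (W y)) x
      fun u => inner ℝ (D V x u) (W x) + inner ℝ (V x) (D W x u) := by
  refine ⟨hV.inner_bundle hW, fun u => ?_⟩
  have h := hD.mvfderiv_inner_eq (FiberBundle.extend (EuclideanSpace ℝ (Fin n)) u) hV hW
  simpa only [FiberBundle.extend_apply_self] using h

lemma SpinStructure.inner_covariantDerivative_frame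
    [IsContMDiffRiemannianBundle (model n) 1 (EuclideanSpace ℝ (Fin n))
      (fun x : M => TangentSpace (model n) x)] (hD : D.IsMetricCompatible)
    (S : SpinStructure n M κ) (hx : x ∈ S.U a) (u : TangentSpace (model n) x) (i j : Fin n) :
    inner ℝ (D (S.frame a i) x u) (S.frame a j x) =
      -inner ℝ (S.frame a i x) (D (S.frame a j) x u) := by
  have hconst : (fun y => inner ℝ (S.frame a i y) (S.frame a j y)) =ᶠ[nhds x]
      fun _ => if i = j then (1 : ℝ) else 0 := by
    filter_upwards [(S.isOpen a).mem_nhds hx] with y hy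
    exact orthonormal_iff_ite.1 (S.frame_orthonormal a y hy) i j
  have h := hasDirDerivAt_inner hD (S.mdifferentiableAt_frame hx i) (S.mdifferentiableAt_frame hx j)
  have h0 := (HasDirDerivAt.const (I := model n) _ x).congr_of_eventuallyEq hconst
  exact eq_neg_of_add_eq_zero_left (h.unique h0 u)

variable (D S a x ρ) in
/-- The endomorphism `½ ∑_{i<j} ⟨D_u e_i, e_j⟩ e_i e_j` of the connection of the spacetime spinor
bundle in the local frame with index `a`. -/
def connOp : TangentSpace (model n) x →ₗ[ℝ] SpacetimeEnd Δ where
  toFun u := spinOp (S.clMul a x ρ) (fun i => S.frame a i x) fun i => D (S.frame a i) x u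
  map_add' u v := by
    simp only [map_add]
    exact spinOp_add _ _ _
  map_smul' r u := by
    simp only [map_smul]
    exact spinOp_smul _ _ _

variable (k S a x ρ) in
/-- The endomorphism `T_u` for which the Killing equation reads `∇_u ψ = -½ T_u ψ`, in the local
frame with index `a`. -/
def killingEnd : TangentSpace (model n) x →ₗ[ℝ] SpacetimeEnd Δ where
  toFun u := killingOp (S.clMul a x ρ) (normalOp Δ) (S.sharp a x (k x u)) u
  map_add' u v := by
    rw [map_add, map_add]
    exact killingOp_add _ _ _ _ _
  map_smul' r u := by
    rw [map_smul, map_smul]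
    exact killingOp_smul _ _ _ _

lemma spinConn_eq (ψ : SpinorField S ρ) (hx : x ∈ S.U a) (u : TangentSpace (model n) x) :
    spinConn D ψ a x u = mvfderiv (model n) (ψ.rep a) x u + connOp D S a x ρ u (ψ.rep a x) := by
  have hsum v φ : S.clMul a x ρ v φ = ∑ l, inner ℝ v (S.frame a l x) • cl ρ l φ := by
    simp only [S.clMul_eq_sum, sum_apply, real_inner_comm v]
    rfl
  have hlin j v φ : S.clMul a x ρ (S.frame a j x) (S.clMul a x ρ v φ) =
      ∑ l, inner ℝ v (S.frame a l x) • cl ρ j (cl ρ l φ) := by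
    rw [hsum v, map_sum]
    refine Finset.sum_congr rfl fun l _ => ?_
    rw [← S.clMul_frame_apply ρ hx j, ← Complex.coe_smul, map_smul, Complex.coe_smul]
  have hquarter (φ : Spacetime Δ) : (1 / 4 : ℝ) • φ = (1 / 4 : ℂ) • φ := by
    rw [← Complex.coe_smul]
    norm_num
  simp only [spinConn, hquarter, ← hlin]
  simp [connOp, spinOp]

lemma killingEnd_frame_apply (hx : x ∈ S.U a) (i : Fin n) (φ : Spacetime Δ) :
    killingEnd k S a x ρ (S.frame a i x) φ =
      ∑ j, k x (S.frame a i x) (S.frame a j x) • cl ρ j (cl0 φ) + Complex.I • cl ρ i φ := by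
  have hsharp χ : S.clMul a x ρ (S.sharp a x (k x (S.frame a i x))) χ =
      ∑ j, k x (S.frame a i x) (S.frame a j x) • cl ρ j χ := by
    simp only [SpinStructure.sharp, LinearMap.coe_mk, AddHom.coe_mk, map_sum, map_smul, sum_apply,
      smul_apply, S.clMul_frame_apply ρ hx]
  rw [← normalOp_apply, ← hsharp, ← S.clMul_frame_apply ρ hx]
  rfl

lemma IsKilling.hasDirDerivAt_rep {ψ : SpinorField S ρ} (hψ : IsKilling D k ψ) (hx : x ∈ S.U a) :
    HasDirDerivAt (model n) (ψ.rep a) x fun u =>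
      -connOp D S a x ρ u (ψ.rep a x) - (1 / 2 : ℂ) • killingEnd k S a x ρ u (ψ.rep a x) := by
  refine ⟨((ψ.contMDiffOn a).contMDiffAt ((S.isOpen a).mem_nhds hx)).mdifferentiableAt one_ne_zero,
    fun u => ?_⟩
  have hlin : IsLinearMap ℝ fun u =>
      -connOp D S a x ρ u (ψ.rep a x) - (1 / 2 : ℂ) • killingEnd k S a x ρ u (ψ.rep a x) := by
    refine ⟨fun v w => ?_, fun r v => ?_⟩
    · simp only [map_add, add_apply]
      module
    · simp only [map_smul, smul_apply]
      module
  have hbasis i : mvfderiv (model n) (ψ.rep a) x (S.orthonormalBasisAt hx i) =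
      hlin.mk' _ (S.orthonormalBasisAt hx i) := by
    have h := hψ a x hx i
    rw [spinConn_eq ψ hx, ← eq_sub_iff_add_eq] at h
    simp only [S.coe_orthonormalBasisAt hx, h, IsLinearMap.mk'_apply, killingEnd_frame_apply hx,
      ← Complex.coe_smul (1 / 2 : ℝ)]
    push_cast
    module
  exact LinearMap.congr_fun ((S.orthonormalBasisAt hx).toBasis.ext
    (f₁ := (mvfderiv (model n) (ψ.rep a) x).toLinearMap) (f₂ := hlin.mk' _)
    (by simpa using hbasis)) u

end SpinConnection

section CovariantDerivative

variable {E : Type*} [NormedAddCommGroup E] [NormedSpace ℝ E] {H : Type*} [TopologicalSpace H]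
  {I : ModelWithCorners ℝ E H} {M : Type*} [TopologicalSpace M] [ChartedSpace H M] {x : M}

/-- The covariant derivative of the local endomorphism field `Q` at `x` is `Q'`, for the connection
`∂ + Ω` on the underlying vector bundle. -/
def HasCovDerivAt {R : Type*} [NormedRing R] [NormedAlgebra ℝ R] (Ω : TangentSpace I x → R)
    (Q : M → R) (Q' : TangentSpace I x → R) : Prop :=
  HasDirDerivAt I Q x fun u => Q' u - (Ω u * Q x - Q x * Ω u)

namespace HasCovDerivAt

variable {R : Type*} [NormedRing R] [NormedAlgebra ℝ R] {Ω : TangentSpace I x → R} {P Q : M → R}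
  {P' Q' : TangentSpace I x → R}

lemma const_of_commute {Q₀ : R} (h : ∀ u, Commute (Ω u) Q₀) :
    HasCovDerivAt Ω (fun _ => Q₀) fun _ => 0 :=
  (HasDirDerivAt.const Q₀ x).congr_deriv fun u => by rw [(h u).eq, sub_self, sub_zero]

lemma mul (hP : HasCovDerivAt Ω P P') (hQ : HasCovDerivAt Ω Q Q') :
    HasCovDerivAt Ω (fun y => P y * Q y) fun u => P' u * Q x + P x * Q' u :=
  (hP.bilinear (ContinuousLinearMap.mul ℝ R).isBoundedBilinearMap hQ).congr_deriv fun u => by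
    simp only [ContinuousLinearMap.mul_apply']
    noncomm_ring

lemma const_smul {R : Type*} [NormedRing R] [NormedAlgebra ℂ R] {Ω : TangentSpace I x → R}
    {Q : M → R} {Q' : TangentSpace I x → R} (z : ℂ) (hQ : HasCovDerivAt Ω Q Q') :
    HasCovDerivAt Ω (fun y => z • Q y) fun u => z • Q' u :=
  (hQ.clm_apply (z • ContinuousLinearMap.id ℝ R)).congr_deriv fun u => by
    simp only [smul_apply, ContinuousLinearMap.id_apply, mul_smul_comm, smul_mul_assoc, smul_sub]

end HasCovDerivAt

variable {𝓢 : Type*} [NormedAddCommGroup 𝓢] [InnerProductSpace ℂ 𝓢]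

lemma HasCovDerivAt.hasDirDerivAt_expectation
    {Ω T : TangentSpace I x → 𝓢 →L[ℂ] 𝓢} {ψ : M → 𝓢} {Q : M → 𝓢 →L[ℂ] 𝓢}
    {Q' : TangentSpace I x → 𝓢 →L[ℂ] 𝓢}
    (hQ : HasCovDerivAt Ω Q Q')
    (hΩ : ∀ u φ χ, inner ℂ (Ω u φ) χ = -inner ℂ φ (Ω u χ))
    (hT : ∀ u φ χ, inner ℂ (T u φ) χ = inner ℂ φ (T u χ))
    (hψ : HasDirDerivAt I ψ x fun u => -Ω u (ψ x) - (1 / 2 : ℂ) • T u (ψ x)) :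
    HasDirDerivAt I (fun y => expectation (ψ y) (Q y)) x fun u =>
      expectation (ψ x) (Q' u - (1 / 2 : ℂ) • (Q x * T u + T u * Q x)) := by
  have hQψ : HasDirDerivAt I (fun y => Q y (ψ y)) x fun u =>
      Q x (-Ω u (ψ x) - (1 / 2 : ℂ) • T u (ψ x)) + (Q' u - (Ω u * Q x - Q x * Ω u)) (ψ x) :=
    hQ.bilinear (ContinuousLinearMap.restrictScalarsL ℂ 𝓢 𝓢 ℝ ℝ).isBoundedBilinearMap hψ
  refine (hψ.bilinear (isBoundedBilinearMap_inner (𝕜 := ℂ)) hQψ).congr_deriv fun u => ?_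
  have hadjoint χ : inner ℂ (-Ω u (ψ x) - (1 / 2 : ℂ) • T u (ψ x)) χ =
      inner ℂ (ψ x) (Ω u χ - (1 / 2 : ℂ) • T u χ) := by
    rw [inner_sub_left, inner_neg_left, hΩ, neg_neg, inner_smul_left, hT, inner_sub_right,
      inner_smul_right, map_div₀, map_one, Complex.conj_ofNat]
  rw [hadjoint, ← inner_add_right, expectation, LinearMap.coe_mk, AddHom.coe_mk]
  congr 1
  simp only [map_sub, map_neg, map_smul, sub_apply, smul_apply, add_apply, mul_apply_eq_comp]
  module

end CovariantDerivative

section Bilinears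

variable {n : ℕ} {M : Type*} [TopologicalSpace M] [ChartedSpace (EuclideanSpace ℝ (Fin n)) M]
  [IsManifold (model n) ∞ M] [RiemannianBundle (fun x : M => TangentSpace (model n) x)]
  {κ : Type*} {S : SpinStructure n M κ} {a : κ} {x : M}
  {Δ : Type*} [NormedAddCommGroup Δ] [InnerProductSpace ℂ Δ] {ρ : SpinorModule n Δ}

namespace SpinorField

variable (ψ : SpinorField S ρ)

lemma inner_X (hx : x ∈ S.U a) (v : TangentSpace (model n) x) :
    inner ℝ (ψ.X x) v = xForm (S.clMul a x ρ) (normalOp Δ) (ψ.rep a x) v := by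
  conv_rhs => rw [← S.sum_frame hx v]
  rw [ψ.X_eq hx, sum_inner, map_sum]
  refine Finset.sum_congr rfl fun i _ => ?_
  rw [real_inner_smul_left, map_smul, xForm_apply, SpinStructure.clMul, LinearMap.comp_apply,
    S.coord_frame hx, real_inner_comm, mul_comm]
  rfl

lemma inner_Y (hx : x ∈ S.U a) (v : TangentSpace (model n) x) :
    inner ℝ (ψ.Y x) v = yForm (S.clMul a x ρ) (ψ.rep a x) v := by
  conv_rhs => rw [← S.sum_frame hx v]
  rw [ψ.Y_eq hx, sum_inner, map_sum]
  refine Finset.sum_congr rfl fun i _ => ?_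
  rw [real_inner_smul_left, map_smul, yForm_apply, SpinStructure.clMul, LinearMap.comp_apply,
    S.coord_frame hx, real_inner_comm, mul_comm]
  rfl

lemma omega_eq_omegaForm (hx : x ∈ S.U a) (v w : TangentSpace (model n) x) :
    ψ.omega x v w = omegaForm (S.clMul a x ρ) (normalOp Δ) (ψ.rep a x) v w := by
  conv_rhs => rw [← S.sum_frame hx v, ← S.sum_frame hx w]
  simp only [ψ.omega_eq hx, map_sum, map_smul, LinearMap.sum_apply, LinearMap.smul_apply,
    omegaForm_apply, SpinStructure.clMul, LinearMap.comp_apply, S.coord_frame hx, smul_eq_mul,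
    Finset.mul_sum]
  rw [Finset.sum_comm]
  refine Finset.sum_congr rfl fun i _ => Finset.sum_congr rfl fun j _ => ?_
  rw [real_inner_comm v, real_inner_comm w, mul_assoc, mul_comm, mul_comm (inner ℝ v _), mul_assoc]
  rfl

lemma sum_mul_omega (hx : x ∈ S.U a)
    (α : TangentSpace (model n) x →L[ℝ] ℝ) (v : TangentSpace (model n) x)
    (e : OrthonormalBasis (Fin n) ℝ (TangentSpace (model n) x)) :
    ∑ l, α (e l) * ψ.omega x v (e l) = ψ.omega x v (S.sharp a x α) := by
  conv_rhs => rw [← e.sum_repr' (S.sharp a x α)]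
  simp only [ψ.omega_eq_omegaForm hx, map_sum, map_smul, smul_eq_mul, ← S.inner_sharp hx α,
    real_inner_comm (e _)]

end SpinorField

variable {D : CovariantDerivative (model n) (EuclideanSpace ℝ (Fin n))
    (fun x : M => TangentSpace (model n) x)}

lemma SpinStructure.hasCovDerivAt_normalOp (S : SpinStructure n M κ) (ρ : SpinorModule n Δ)
    (hx : x ∈ S.U a) : HasCovDerivAt (connOp D S a x ρ) (fun _ => normalOp Δ) fun _ => 0 :=
  .const_of_commute fun _ => (S.isHermitianClifford_clMul ρ hx).spinOp_commute_normal _ _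

variable [IsContMDiffRiemannianBundle (model n) 1 (EuclideanSpace ℝ (Fin n))
    (fun x : M => TangentSpace (model n) x)]
  {k : (x : M) → TangentSpace (model n) x →L[ℝ] TangentSpace (model n) x →L[ℝ] ℝ}
  {V : (x : M) → TangentSpace (model n) x}

lemma SpinStructure.hasCovDerivAt_clMul (S : SpinStructure n M κ) (hD : D.IsMetricCompatible)
    (ρ : SpinorModule n Δ) (hx : x ∈ S.U a)
    (hV : MDifferentiableFieldAt V x) :
    HasCovDerivAt (connOp D S a x ρ) (fun y => S.clMul a y ρ (V y))
      fun u => S.clMul a x ρ (D V x u) := by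
  let E i : SpacetimeEnd Δ := vecOp ρ (EuclideanSpace.single i 1)
  have hsum : HasDirDerivAt (model n) (fun y => S.clMul a y ρ (V y)) x fun u =>
      ∑ i, (inner ℝ (D (S.frame a i) x u) (V x) + inner ℝ (S.frame a i x) (D V x u)) • E i := by
    simp only [S.clMul_eq_sum]
    exact .sum _ fun i _ =>
      (hasDirDerivAt_inner hD (S.mdifferentiableAt_frame hx i) hV).smul_const (E i)
  refine hsum.congr_deriv fun u => ?_
  have hcomm : connOp D S a x ρ u * S.clMul a x ρ (V x) - S.clMul a x ρ (V x) * connOp D S a x ρ u =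
      -∑ i, inner ℝ (V x) (D (S.frame a i) x u) • E i := by
    have h := (S.isHermitianClifford_clMul ρ hx).spinOp_commutator (e := S.orthonormalBasisAt hx)
      (by simpa using S.inner_covariantDerivative_frame hD hx u) (V x)
    simp only [S.coe_orthonormalBasisAt hx] at h
    simp only [SpinStructure.clMul, LinearMap.comp_apply, S.coord_frame hx] at h
    exact h
  beta_reduce
  rw [hcomm, S.clMul_eq_sum, sub_neg_eq_add, ← Finset.sum_add_distrib]
  refine Finset.sum_congr rfl fun i _ => ?_
  rw [add_comm, real_inner_comm (V x)]
  exact add_smul (inner ℝ (S.frame a i x) (D V x u)) _ (E i)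

variable {ψ : SpinorField S ρ}

lemma IsKilling.hasDirDerivAt_expectation (hD : D.IsMetricCompatible) (hψ : IsKilling D k ψ)
    (hx : x ∈ S.U a) {Q : M → SpacetimeEnd Δ} {Q' : TangentSpace (model n) x → SpacetimeEnd Δ}
    (hQ : HasCovDerivAt (connOp D S a x ρ) Q Q') :
    HasDirDerivAt (model n) (fun y => expectation (ψ.rep a y) (Q y)) x fun u =>
      expectation (ψ.rep a x) (Q' u - (1 / 2 : ℂ) •
        (Q x * killingEnd k S a x ρ u + killingEnd k S a x ρ u * Q x)) := by
  have hc := S.isHermitianClifford_clMul ρ hx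
  have hΩ u φ χ : inner ℂ (connOp D S a x ρ u φ) χ = -inner ℂ φ (connOp D S a x ρ u χ) := by
    have h := inner_spinOp (c := S.clMul a x ρ) (e := S.orthonormalBasisAt hx) hc.inner_vector
      (by simpa using S.inner_covariantDerivative_frame hD hx u) φ χ
    rwa [S.coe_orthonormalBasisAt hx] at h
  have hT u φ χ : inner ℂ (killingEnd k S a x ρ u φ) χ = inner ℂ φ (killingEnd k S a x ρ u χ) :=
    hc.inner_killingOp _ _ φ χ
  exact hQ.hasDirDerivAt_expectation hΩ hT (hψ.hasDirDerivAt_rep hx)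

end Bilinears

section KillingSpinor

variable {n : ℕ} {M : Type*} [TopologicalSpace M] [ChartedSpace (EuclideanSpace ℝ (Fin n)) M]
  [IsManifold (model n) ∞ M] [RiemannianBundle (fun x : M => TangentSpace (model n) x)]
  [IsContMDiffRiemannianBundle (model n) 1 (EuclideanSpace ℝ (Fin n))
    (fun x : M => TangentSpace (model n) x)]
  {D : CovariantDerivative (model n) (EuclideanSpace ℝ (Fin n))
    (fun x : M => TangentSpace (model n) x)}
  {k : (x : M) → TangentSpace (model n) x →L[ℝ] TangentSpace (model n) x →L[ℝ] ℝ}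
  {κ : Type*} {S : SpinStructure n M κ} {a : κ} {x : M}
  {Δ : Type*} [NormedAddCommGroup Δ] [InnerProductSpace ℂ Δ] {ρ : SpinorModule n Δ}
  {ψ : SpinorField S ρ} {V W : (x : M) → TangentSpace (model n) x}

namespace IsKilling

variable (hψ : IsKilling D k ψ) (hD : D.IsMetricCompatible)
include hψ hD

lemma hasDirDerivAt_N (x : M) :
    HasDirDerivAt (model n) ψ.N x fun u => -k x u (ψ.X x) - inner ℝ (ψ.Y x) u := by
  obtain ⟨a, hx⟩ := S.cover x
  have hN : ψ.N =ᶠ[nhds x] fun y => (expectation (ψ.rep a y) 1).re := by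
    filter_upwards [(S.isOpen a).mem_nhds hx] with y hy
    rw [ψ.N_eq hy, re_expectation_one]
  refine .congr_of_eventuallyEq ?_ hN
  refine ((hψ.hasDirDerivAt_expectation hD hx
    (.const_of_commute fun _ => .one_right _)).clm_apply Complex.reCLM).congr_deriv fun u => ?_
  have h := re_expectation_sub_killingOp (c := S.clMul a x ρ)
    (e₀ := normalOp Δ) 0 (ψ.rep a x) (S.sharp a x (k x u)) u
  refine h.trans ?_
  rw [← ψ.inner_X hx, ← ψ.inner_Y hx, real_inner_comm, S.inner_sharp hx, map_zero, Complex.zero_re,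
    zero_sub]

lemma hasDirDerivAt_inner_X
    (hV : MDifferentiableFieldAt V x) :
    HasDirDerivAt (model n) (fun y => inner ℝ (ψ.X y) (V y)) x fun u =>
      inner ℝ (ψ.X x) (D V x u) + (-k x u (V x) * ψ.N x + ψ.omega x u (V x)) := by
  obtain ⟨a, hx⟩ := S.cover x
  have hX : (fun y => inner ℝ (ψ.X y) (V y)) =ᶠ[nhds x]
      fun y => (expectation (ψ.rep a y) (S.clMul a y ρ (V y) * normalOp Δ)).re := by
    filter_upwards [(S.isOpen a).mem_nhds hx] with y hy
    rw [ψ.inner_X hy, xForm_apply]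
  refine .congr_of_eventuallyEq ?_ hX
  have hQ := (S.hasCovDerivAt_clMul hD ρ hx hV).mul (S.hasCovDerivAt_normalOp ρ hx)
  refine ((hψ.hasDirDerivAt_expectation hD hx hQ).clm_apply Complex.reCLM).congr_deriv fun u => ?_
  have h := (S.isHermitianClifford_clMul ρ hx).re_expectation_mul_normal_sub_killingOp
    (S.clMul a x ρ (D V x u) * normalOp Δ + S.clMul a x ρ (V x) * 0)
    (ψ.rep a x) (S.sharp a x (k x u)) u (V x)
  refine h.trans ?_
  rw [S.inner_sharp hx, ← ψ.N_eq hx, ← ψ.omega_eq_omegaForm hx, mul_zero, add_zero, ← xForm_apply,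
    ← ψ.inner_X hx]
  ring

lemma hasDirDerivAt_inner_Y (hx : x ∈ S.U a)
    (hV : MDifferentiableFieldAt V x) :
    HasDirDerivAt (model n) (fun y => inner ℝ (ψ.Y y) (V y)) x fun u =>
      inner ℝ (ψ.Y x) (D V x u) +
        (-inner ℝ u (V x) * ψ.N x + ψ.omega x (V x) (S.sharp a x (k x u))) := by
  have hY : (fun y => inner ℝ (ψ.Y y) (V y)) =ᶠ[nhds x]
      fun y => (expectation (ψ.rep a y) (Complex.I • S.clMul a y ρ (V y))).re := by
    filter_upwards [(S.isOpen a).mem_nhds hx] with y hy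
    rw [ψ.inner_Y hy, yForm_apply]
  refine .congr_of_eventuallyEq ?_ hY
  have hQ := (S.hasCovDerivAt_clMul hD ρ hx hV).const_smul Complex.I
  refine ((hψ.hasDirDerivAt_expectation hD hx hQ).clm_apply Complex.reCLM).congr_deriv fun u => ?_
  have h := (S.isHermitianClifford_clMul ρ hx).re_expectation_smul_sub_killingOp
    (Complex.I • S.clMul a x ρ (D V x u)) (ψ.rep a x) (S.sharp a x (k x u)) u (V x)
  refine h.trans ?_
  rw [← ψ.N_eq hx, ← ψ.omega_eq_omegaForm hx, ← yForm_apply, ← ψ.inner_Y hx]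
  ring

lemma hasDirDerivAt_omega
    (hV : MDifferentiableFieldAt V x) (hW : MDifferentiableFieldAt W x) :
    HasDirDerivAt (model n) (fun y => ψ.omega y (V y) (W y)) x fun u =>
      ψ.omega x (D V x u) (W x) + ψ.omega x (V x) (D W x u) +
        (inner ℝ u (V x) * inner ℝ (ψ.X x) (W x) - inner ℝ u (W x) * inner ℝ (ψ.X x) (V x)
          - k x u (V x) * inner ℝ (ψ.Y x) (W x) + k x u (W x) * inner ℝ (ψ.Y x) (V x)) := by
  obtain ⟨a, hx⟩ := S.cover x
  have hω : (fun y => ψ.omega y (V y) (W y)) =ᶠ[nhds x] fun y =>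
      (expectation (ψ.rep a y) (S.clMul a y ρ (V y) * S.clMul a y ρ (W y) * normalOp Δ)).im := by
    filter_upwards [(S.isOpen a).mem_nhds hx] with y hy
    rw [ψ.omega_eq_omegaForm hy, omegaForm_apply]
  refine .congr_of_eventuallyEq ?_ hω
  have hQ := ((S.hasCovDerivAt_clMul hD ρ hx hV).mul (S.hasCovDerivAt_clMul hD ρ hx hW)).mul
    (S.hasCovDerivAt_normalOp ρ hx)
  refine ((hψ.hasDirDerivAt_expectation hD hx hQ).clm_apply Complex.imCLM).congr_deriv fun u => ?_
  have h := (S.isHermitianClifford_clMul ρ hx).im_expectation_mul_mul_normal_sub_killingOp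
    ((S.clMul a x ρ (D V x u) * S.clMul a x ρ (W x)
      + S.clMul a x ρ (V x) * S.clMul a x ρ (D W x u)) * normalOp Δ
      + S.clMul a x ρ (V x) * S.clMul a x ρ (W x) * 0)
    (ψ.rep a x) (S.sharp a x (k x u)) u (V x) (W x)
  refine h.trans ?_
  rw [S.inner_sharp hx, S.inner_sharp hx, mul_zero, add_zero, add_mul, map_add, Complex.add_im,
    ← omegaForm_apply, ← omegaForm_apply, ← ψ.omega_eq_omegaForm hx, ← ψ.omega_eq_omegaForm hx,
    ← ψ.inner_X hx, ← ψ.inner_X hx, ← ψ.inner_Y hx, ← ψ.inner_Y hx]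
  ring

end IsKilling

end KillingSpinor

section FirstOrderSystem

variable {n : ℕ} {M : Type*} [TopologicalSpace M] [ChartedSpace (EuclideanSpace ℝ (Fin n)) M]
  [IsManifold (model n) ∞ M] [RiemannianBundle (fun x : M => TangentSpace (model n) x)]
  {κ : Type*} {x : M} {Z : (x : M) → TangentSpace (model n) x}

lemma SpinStructure.mdifferentiableAt_of_inner_frame (S : SpinStructure n M κ) {a : κ}
    (hx : x ∈ S.U a)
    (hZ : ∀ i, MDifferentiableAt (model n) 𝓘(ℝ, ℝ)
      (fun y => inner ℝ (Z y) (S.frame a i y)) x) :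
    MDifferentiableFieldAt Z x := by
  have hsum := MDifferentiableAt.sum_section (s := Finset.univ) fun i _ =>
    (hZ i).smul_section (S.mdifferentiableAt_frame hx i)
  refine hsum.congr_of_eventuallyEq ?_
  filter_upwards [(S.isOpen a).mem_nhds hx] with y hy
  exact congrArg (TotalSpace.mk y) (S.sum_frame hy (Z y)).symm

variable [IsContMDiffRiemannianBundle (model n) 1 (EuclideanSpace ℝ (Fin n))
    (fun x : M => TangentSpace (model n) x)]
  {D : CovariantDerivative (model n) (EuclideanSpace ℝ (Fin n))
    (fun x : M => TangentSpace (model n) x)}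

lemma SpinStructure.covariantDerivative_of_hasDirDerivAt_inner (S : SpinStructure n M κ)
    (hD : D.IsMetricCompatible) {B : TangentSpace (model n) x → TangentSpace (model n) x → ℝ}
    (hZ : ∀ V : (x : M) → TangentSpace (model n) x,
      MDifferentiableFieldAt V x → HasDirDerivAt (model n) (fun y => inner ℝ (Z y) (V y)) x
        fun u => inner ℝ (Z x) (D V x u) + B u (V x)) :
    MDifferentiableFieldAt Z x ∧ ∀ u v, inner ℝ (D Z x u) v = B u v := by
  obtain ⟨a, hx⟩ := S.cover x
  have hdiff := S.mdifferentiableAt_of_inner_frame hx fun i =>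
    (hZ _ (S.mdifferentiableAt_frame hx i)).1
  refine ⟨hdiff, fun u v => ?_⟩
  have hv := FiberBundle.mdifferentiableAt_extend (model n) (EuclideanSpace ℝ (Fin n)) v
  have h := (hasDirDerivAt_inner hD hdiff hv).unique (hZ _ hv) u
  rw [FiberBundle.extend_apply_self] at h
  linarith

variable
  {k : (x : M) → TangentSpace (model n) x →L[ℝ] TangentSpace (model n) x →L[ℝ] ℝ}
  {S : SpinStructure n M κ}
  {Δ : Type*} [NormedAddCommGroup Δ] [InnerProductSpace ℂ Δ] {ρ : SpinorModule n Δ}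
  {ψ : SpinorField S ρ}

namespace IsKilling

variable (hψ : IsKilling D k ψ) (hD : D.IsMetricCompatible)
include hψ hD

lemma covariantDerivative_X (x : M) :
    MDifferentiableFieldAt ψ.X x ∧
      ∀ u v, inner ℝ (D ψ.X x u) v = -k x u v * ψ.N x + ψ.omega x u v :=
  S.covariantDerivative_of_hasDirDerivAt_inner hD fun _ hV => hψ.hasDirDerivAt_inner_X hD hV

lemma covariantDerivative_Y {a : κ} (hx : x ∈ S.U a) :
    MDifferentiableFieldAt ψ.Y x ∧
      ∀ u v, inner ℝ (D ψ.Y x u) v =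
        -inner ℝ u v * ψ.N x + ψ.omega x v (S.sharp a x (k x u)) :=
  S.covariantDerivative_of_hasDirDerivAt_inner hD fun _ hV => hψ.hasDirDerivAt_inner_Y hD hx hV

end IsKilling

end FirstOrderSystem

section ConservedQuantity

variable {n : ℕ} {M : Type*} [TopologicalSpace M] [ChartedSpace (EuclideanSpace ℝ (Fin n)) M]
  [IsManifold (model n) ∞ M] [RiemannianBundle (fun x : M => TangentSpace (model n) x)]
  {κ : Type*} {S : SpinStructure n M κ} {a : κ} {x : M}
  {Δ : Type*} [NormedAddCommGroup Δ] [InnerProductSpace ℂ Δ] {ρ : SpinorModule n Δ}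

/-- The function `N² - |X|² - |Y|² + ½ |ω|²`, with `|ω|²` computed in some local frame. -/
def SpinorField.conserved (ψ : SpinorField S ρ) (x : M) : ℝ :=
  ψ.N x ^ 2 - ‖ψ.X x‖ ^ 2 - ‖ψ.Y x‖ ^ 2 + 1 / 2 * ∑ i, ∑ j,
    ψ.omega x (S.frame (S.indexAt x) i x) (S.frame (S.indexAt x) j x) ^ 2

lemma SpinorField.conserved_eq (ψ : SpinorField S ρ) (x : M)
    (e : OrthonormalBasis (Fin n) ℝ (TangentSpace (model n) x)) :
    ψ.conserved x = ψ.N x ^ 2 - ‖ψ.X x‖ ^ 2 - ‖ψ.Y x‖ ^ 2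
      + 1 / 2 * ∑ i, ∑ j, ψ.omega x (e i) (e j) ^ 2 := by
  have hx : x ∈ S.U (S.indexAt x) := (S.cover x).choose_spec
  have h := sum_sum_sq_bilin_eq (omegaForm (S.clMul (S.indexAt x) x ρ) (normalOp Δ)
    (ψ.rep (S.indexAt x) x)) e (S.orthonormalBasisAt hx)
  simp only [S.coe_orthonormalBasisAt hx, ← ψ.omega_eq_omegaForm hx] at h
  rw [h, conserved]

variable [IsContMDiffRiemannianBundle (model n) 1 (EuclideanSpace ℝ (Fin n))
    (fun x : M => TangentSpace (model n) x)]
  {D : CovariantDerivative (model n) (EuclideanSpace ℝ (Fin n))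
    (fun x : M => TangentSpace (model n) x)}
  {k : (x : M) → TangentSpace (model n) x →L[ℝ] TangentSpace (model n) x →L[ℝ] ℝ}
  {ψ : SpinorField S ρ}

namespace IsKilling

variable (hψ : IsKilling D k ψ) (hD : D.IsMetricCompatible)
include hψ hD

lemma hasDirDerivAt_normSq_N_sub_X_sub_Y (hx : x ∈ S.U a) :
    HasDirDerivAt (model n) (fun y => ψ.N y ^ 2 - ‖ψ.X y‖ ^ 2 - ‖ψ.Y y‖ ^ 2) x fun u =>
      -(2 * ψ.omega x u (ψ.X x) + 2 * ψ.omega x (ψ.Y x) (S.sharp a x (k x u))) := by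
  obtain ⟨hX, hDX⟩ := hψ.covariantDerivative_X hD x
  obtain ⟨hY, hDY⟩ := hψ.covariantDerivative_Y hD hx
  simp only [← real_inner_self_eq_norm_sq]
  refine (((hψ.hasDirDerivAt_N hD x).sq.sub (hψ.hasDirDerivAt_inner_X hD hX)).sub
    (hψ.hasDirDerivAt_inner_Y hD hx hY)).congr_deriv fun u => ?_
  rw [real_inner_comm _ (ψ.X x), hDX, real_inner_comm (D ψ.Y x u), hDY, real_inner_comm u]
  ring

lemma hasDirDerivAt_normSq_omega (hx : x ∈ S.U a) :
    HasDirDerivAt (model n)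
      (fun y => ∑ i, ∑ j, ψ.omega y (S.frame a i y) (S.frame a j y) ^ 2) x fun u =>
        4 * (ψ.omega x u (ψ.X x) + ψ.omega x (ψ.Y x) (S.sharp a x (k x u))) := by
  have hderiv i j := (hψ.hasDirDerivAt_omega hD (S.mdifferentiableAt_frame hx i)
    (S.mdifferentiableAt_frame hx j)).sq
  refine (HasDirDerivAt.sum _ fun i _ => .sum _ fun j _ => hderiv i j).congr_deriv fun u => ?_
  have h := sum_sum_bilin_mul_skew_add_wedge (e := S.orthonormalBasisAt hx)
    ((S.isHermitianClifford_clMul ρ hx).omegaForm_antisymm (ψ.rep a x))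
    (by simpa using S.inner_covariantDerivative_frame hD hx u)
    u (S.sharp a x (k x u)) (ψ.X x) (ψ.Y x)
  simpa only [S.coe_orthonormalBasisAt hx, S.inner_sharp hx, ← ψ.omega_eq_omegaForm hx] using h

lemma hasDirDerivAt_conserved (x : M) : HasDirDerivAt (model n) ψ.conserved x fun _ => 0 := by
  obtain ⟨a, hx⟩ := S.cover x
  have hlocal : ψ.conserved =ᶠ[nhds x] fun y => ψ.N y ^ 2 - ‖ψ.X y‖ ^ 2 - ‖ψ.Y y‖ ^ 2
      + 1 / 2 * ∑ i, ∑ j, ψ.omega y (S.frame a i y) (S.frame a j y) ^ 2 := by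
    filter_upwards [(S.isOpen a).mem_nhds hx] with y hy
    rw [ψ.conserved_eq y (S.orthonormalBasisAt hy), S.coe_orthonormalBasisAt hy]
  refine .congr_of_eventuallyEq ?_ hlocal
  refine ((hψ.hasDirDerivAt_normSq_N_sub_X_sub_Y hD hx).add
    ((hψ.hasDirDerivAt_normSq_omega hD hx).const_mul (1 / 2))).congr_deriv fun u => ?_
  ring

end IsKilling

end ConservedQuantity

end KillingBilinears

end

open KillingBilinears in
theorem mainTheorem10_general {n : ℕ} {M : Type*} [TopologicalSpace M]
    [ChartedSpace (EuclideanSpace ℝ (Fin n)) M]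
    [IsManifold (model n) ∞ M] [ConnectedSpace M]
    [RiemannianBundle (fun x : M => TangentSpace (model n) x)]
    [IsContMDiffRiemannianBundle (model n) 1 (EuclideanSpace ℝ (Fin n))
      (fun x : M => TangentSpace (model n) x)]
    (D : CovariantDerivative (model n) (EuclideanSpace ℝ (Fin n))
      (fun x : M => TangentSpace (model n) x))
    (hD : D.IsMetricCompatible)
    (k : (x : M) → TangentSpace (model n) x →L[ℝ]
      TangentSpace (model n) x →L[ℝ] ℝ)
    {κ : Type*} (S : SpinStructure n M κ)
    {Δ : Type*} [NormedAddCommGroup Δ] [InnerProductSpace ℂ Δ]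
    (ρ : SpinorModule n Δ)
    (ψ : SpinorField S ρ) (hψ : IsKilling D k ψ) :
    (∀ x : M,
      (MDifferentiableAt (model n) 𝓘(ℝ, ℝ) ψ.N x ∧
        ∀ u, mvfderiv (model n) ψ.N x u =
          -k x u (ψ.X x) - inner ℝ (ψ.Y x) u) ∧
      (MDifferentiableAt (model n)
        ((model n).prod 𝓘(ℝ, EuclideanSpace ℝ (Fin n))) (T% ψ.X) x ∧
        ∀ u v, inner ℝ (D ψ.X x u) v = -k x u v * ψ.N x + ψ.omega x u v) ∧
      (MDifferentiableAt (model n)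
        ((model n).prod 𝓘(ℝ, EuclideanSpace ℝ (Fin n))) (T% ψ.Y) x ∧
        ∀ u v, ∀ e : OrthonormalBasis (Fin n) ℝ (TangentSpace (model n) x),
          inner ℝ (D ψ.Y x u) v =
            -inner ℝ u v * ψ.N x + ∑ l, k x u (e l) * ψ.omega x v (e l)) ∧
      (∀ V W : (y : M) → TangentSpace (model n) y,
        MDifferentiableAt (model n)
        ((model n).prod 𝓘(ℝ, EuclideanSpace ℝ (Fin n))) (T% V) x →
        MDifferentiableAt (model n)
        ((model n).prod 𝓘(ℝ, EuclideanSpace ℝ (Fin n))) (T% W) x →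
        MDifferentiableAt (model n) 𝓘(ℝ, ℝ)
          (fun y => ψ.omega y (V y) (W y)) x ∧
        ∀ u, covDeriv₂ D ψ.omega V W x u =
          inner ℝ u (V x) * inner ℝ (ψ.X x) (W x) - inner ℝ u (W x) * inner ℝ (ψ.X x) (V x)
            - k x u (V x) * inner ℝ (ψ.Y x) (W x) + k x u (W x) * inner ℝ (ψ.Y x) (V x))) ∧
    (∃ c : ℝ, ∀ x : M,
      ∀ e : OrthonormalBasis (Fin n) ℝ (TangentSpace (model n) x),
        ψ.N x ^ 2 - ‖ψ.X x‖ ^ 2 - ‖ψ.Y x‖ ^ 2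
          + 1 / 2 * ∑ i, ∑ j, ψ.omega x (e i) (e j) ^ 2 = c) := by
  refine ⟨fun x => ?_, ?_⟩
  · obtain ⟨a, hx⟩ := S.cover x
    obtain ⟨hY, hDY⟩ := hψ.covariantDerivative_Y hD hx
    refine ⟨hψ.hasDirDerivAt_N hD x, hψ.covariantDerivative_X hD x, ⟨hY, fun u v e => ?_⟩,
      fun V W hV hW => ?_⟩
    · rw [hDY, ψ.sum_mul_omega hx]
    · obtain ⟨hω, hDω⟩ := hψ.hasDirDerivAt_omega hD hV hW
      refine ⟨hω, fun u => ?_⟩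
      rw [covDeriv₂, hDω]
      ring
  · obtain ⟨c, hc⟩ := exists_eq_const_of_hasDirDerivAt_zero
      (hψ.hasDirDerivAt_conserved hD)
    exact ⟨c, fun x e => (ψ.conserved_eq x e).symm.trans (hc x)⟩

theorem mainTheorem10 {n : ℕ} {M : Type*} [TopologicalSpace M]
    [ChartedSpace (EuclideanSpace ℝ (Fin n)) M]
    [IsManifold (KillingBilinears.model n) ∞ M] [ConnectedSpace M]
    [RiemannianBundle (fun x : M => TangentSpace (KillingBilinears.model n) x)]
    [IsContMDiffRiemannianBundle (KillingBilinears.model n) 1 (EuclideanSpace ℝ (Fin n))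
      (fun x : M => TangentSpace (KillingBilinears.model n) x)]
    (D : CovariantDerivative (KillingBilinears.model n) (EuclideanSpace ℝ (Fin n))
      (fun x : M => TangentSpace (KillingBilinears.model n) x))
    (hD : KillingBilinears.IsLeviCivita D)
    (k : (x : M) → TangentSpace (KillingBilinears.model n) x →L[ℝ]
      TangentSpace (KillingBilinears.model n) x →L[ℝ] ℝ)
    (hk : ∀ x u v, k x u v = k x v u)
    {κ : Type*} (S : KillingBilinears.SpinStructure n M κ)
    {Δ : Type*} [NormedAddCommGroup Δ] [InnerProductSpace ℂ Δ] [FiniteDimensional ℂ Δ]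
    (ρ : KillingBilinears.SpinorModule n Δ)
    (ψ : KillingBilinears.SpinorField S ρ) (hψ : KillingBilinears.IsKilling D k ψ) :
    -- `N`, `X`, `Y`, `ω` are differentiable and satisfy the first-order system
    (∀ x : M,
      (MDifferentiableAt (KillingBilinears.model n) 𝓘(ℝ, ℝ) ψ.N x ∧
        ∀ u, mvfderiv (KillingBilinears.model n) ψ.N x u =
          -k x u (ψ.X x) - inner ℝ (ψ.Y x) u) ∧
      (MDifferentiableAt (KillingBilinears.model n)
        ((KillingBilinears.model n).prod 𝓘(ℝ, EuclideanSpace ℝ (Fin n))) (T% ψ.X) x ∧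
        ∀ u v, inner ℝ (D ψ.X x u) v = -k x u v * ψ.N x + ψ.omega x u v) ∧
      (MDifferentiableAt (KillingBilinears.model n)
        ((KillingBilinears.model n).prod 𝓘(ℝ, EuclideanSpace ℝ (Fin n))) (T% ψ.Y) x ∧
        ∀ u v, ∀ e : OrthonormalBasis (Fin n) ℝ (TangentSpace (KillingBilinears.model n) x),
          inner ℝ (D ψ.Y x u) v =
            -inner ℝ u v * ψ.N x + ∑ l, k x u (e l) * ψ.omega x v (e l)) ∧
      (∀ V W : (y : M) → TangentSpace (KillingBilinears.model n) y,
        MDifferentiableAt (KillingBilinears.model n)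
        ((KillingBilinears.model n).prod 𝓘(ℝ, EuclideanSpace ℝ (Fin n))) (T% V) x → MDifferentiableAt (KillingBilinears.model n)
        ((KillingBilinears.model n).prod 𝓘(ℝ, EuclideanSpace ℝ (Fin n))) (T% W) x →
        MDifferentiableAt (KillingBilinears.model n) 𝓘(ℝ, ℝ)
          (fun y => ψ.omega y (V y) (W y)) x ∧
        ∀ u, KillingBilinears.covDeriv₂ D ψ.omega V W x u =
          inner ℝ u (V x) * inner ℝ (ψ.X x) (W x) - inner ℝ u (W x) * inner ℝ (ψ.X x) (V x)
            - k x u (V x) * inner ℝ (ψ.Y x) (W x) + k x u (W x) * inner ℝ (ψ.Y x) (V x))) ∧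
    -- the quantity `N² - |X|² - |Y|² + ½ |ω|²` is constant
    (∃ c : ℝ, ∀ x : M,
      ∀ e : OrthonormalBasis (Fin n) ℝ (TangentSpace (KillingBilinears.model n) x),
        ψ.N x ^ 2 - ‖ψ.X x‖ ^ 2 - ‖ψ.Y x‖ ^ 2
          + 1 / 2 * ∑ i, ∑ j, ψ.omega x (e i) (e j) ^ 2 = c) :=
  mainTheorem10_general D hD.metric k S ρ ψ hψ
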